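/- Setting. Let $f:\mathbb R^n\to(-\infty,\infty]$ and $g:\mathbb R^m\to(-\infty,\infty]$ be proper, lower semicontinuous, convex functions, let $A\in\mathbb R^{m\times n}$, $B\in\mathbb R^{r\times n}$, $b\in\mathbb R^r$, and let $\lambda,\mu\in\mathbb R^r$ have strictly positive entries. Put $Q=[A;B]$, $w=[y;z]\in\mathbb R^m\times\mathbb R^r$, so that $Q^\top w=A^\top y+B^\top z$, and $$\Theta(x)=f(x)+g(Ax),\qquad \Xi(w)=f^*(-Q^\top w)+g^*(y)+\langle b,z\rangle ,$$ where $*$ is the convex conjugate. Consider the problems $$\text{(P)}\ \ \inf_{x\in\mathbb R^n}\ \Theta(x)+\Phi_\lambda(Bx-b),\qquad \text{(D)}\ \ \inf_{w=[y;z]}\ \Xi(w)+\Psi_\mu(z),$$ where $(\Phi_\lambda,\Psi_\mu)$ is either $(\Phi_{+,\lambda},\Psi_{+,\mu})$ or $(\Phi_{0,\lambda},\Psi_{0,\mu})$, with $$\Phi_{+,\lambda}(u)=\sum_{i:\,u_i>0}\lambda_i,\quad \Phi_{0,\lambda}(u)=\sum_{i:\,u_i\ne0}\lambda_i,\quad \Psi_{0,\mu}(z)=\sum_{i:\,z_i\neq0}\mu_i,\quad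 \Psi_{+,\mu}(z)=\Psi_{0,\mu}(z)+\delta(z\,|\,\mathbb R^r_+),$$ and $\delta(\cdot\,|\,U)$ is $0$ on $U$ and $+\infty$ elsewhere. A local minimizer is a point with finite objective value that minimizes the objective in some neighbourhood of itself, and $\partial$ is the limiting (Mordukhovich) subdifferential, which for proper lsc convex functions is the subdifferential of convex analysis. A function is polyhedral if its epigraph is an intersection of finitely many closed half-spaces. For a proper convex function $\psi$ let $S(\psi)=\operatorname{dom}\psi$ if $\psi$ is polyhedral and $S(\psi)=\operatorname{ri}(\operatorname{dom}\psi)$ otherwise. Slater conditions. The primal Slater condition at $x^*$ is that there is an $x$ with $x\in S(f)$, $Ax\in S(g)$ and, for every $i$ with $(Bx^*-b)_i=0$, $(Bx-b)_i\le 0$ in the case of $\Phi_{+,\lambda}$, respectively $(Bx-b)_i=0$ in the case of $\Phi_{0,\lambda}$. The dual Slater condition at $w^*=[y^*;z^*]$ is that there is a $w=[y;z]$ with $-Q^\top w\in S(f^*)$, $y\in S(g^*)$, $z_i=0$ for every $i$ with $z^*_i=0$ and, in the case of $\Psi_{+,\mu}$ only, $z_i\ge 0$ for every $i$ with $z_i^*\ne0$.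 Theorem. In each of the two cases the following holds. (i) If $x^*$ is a local minimizer of (P) and the primal Slater condition holds at $x^*$, then there exist $y^*\in\partial g(Ax^*)$ and $z^*\in\partial\Phi_\lambda(Bx^*-b)$ such that $w^*=[y^*;z^*]$ is a local minimizer of (D) and $\Theta(x^*)=-\Xi(w^*)$. (ii) If $w^*$ is a local minimizer of (D) and the dual Slater condition holds at $w^*$, then there exists $x^*\in\partial f^*(-Q^\top w^*)$ such that $x^*$ is a local minimizer of (P) and $\Theta(x^*)=-\Xi(w^*)$. -/

import Mathlib

open Filter Topology

noncomputable section

namespace CCOP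

/-- The Euclidean space of dimension `n`. -/
abbrev Vec (n : ℕ) : Type := EuclideanSpace ℝ (Fin n)

/-- The matrix-vector product, between Euclidean spaces. -/
def mv {m n : ℕ} (A : Matrix (Fin m) (Fin n) ℝ) (x : Vec n) : Vec m :=
  WithLp.toLp 2 (A.mulVec x.ofLp)

section Convex

variable {E : Type*} [NormedAddCommGroup E] [InnerProductSpace ℝ E]

/-- The effective domain of an extended-real-valued function. -/
def dom (ψ : E → EReal) : Set E := {x | ψ x < ⊤}

/-- The epigraph of an extended-real-valued function. -/
def epi (ψ : E → EReal) : Set (E × ℝ) := {p | ψ p.1 ≤ (p.2 : EReal)}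

/-- Proper, lower semicontinuous, convex functions with values in `(-∞, ∞]`. -/
structure ProperLscConvex (ψ : E → EReal) : Prop where
  ne_bot : ∀ x, ψ x ≠ ⊥
  dom_nonempty : (dom ψ).Nonempty
  lsc : LowerSemicontinuous ψ
  convex : Convex ℝ (epi ψ)

/-- A polyhedral function: its epigraph is the intersection of finitely many closed half-spaces
of `E × ℝ`. -/
def IsPolyhedral (ψ : E → EReal) : Prop :=
  ∃ (k : ℕ) (a : Fin k → E) (α β : Fin k → ℝ),
    epi ψ = {p | ∀ i, inner ℝ (a i) p.1 + α i * p.2 ≤ β i}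

/-- The set in which a Slater condition asks for a point: the relative interior of the domain,
or just the domain if the function is polyhedral. -/
def slaterDom (ψ : E → EReal) : Set E :=
  {x | x ∈ intrinsicInterior ℝ (dom ψ) ∨ (IsPolyhedral ψ ∧ x ∈ dom ψ)}

/-- The convex conjugate. -/
def conj (ψ : E → EReal) (q : E) : EReal :=
  ⨆ x : E, ((inner ℝ q x : ℝ) : EReal) - ψ x

/-- The Fréchet subdifferential; it is empty outside the domain. -/
def frechetSubdiff (ψ : E → EReal) (x : E) : Set E :=
  {q | x ∈ dom ψ ∧
    0 ≤ liminf (fun x' : E =>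
      (ψ x' - ψ x - ((inner ℝ q (x' - x) : ℝ) : EReal)) / ((‖x' - x‖ : ℝ) : EReal)) (𝓝[≠] x)}

/-- The limiting (Mordukhovich) subdifferential; it is empty outside the domain. -/
def subdiff (ψ : E → EReal) (x : E) : Set E :=
  {q | x ∈ dom ψ ∧ ∃ (xs qs : ℕ → E),
    Tendsto xs atTop (𝓝 x) ∧ Tendsto (fun k => ψ (xs k)) atTop (𝓝 (ψ x)) ∧
    (∀ k, qs k ∈ frechetSubdiff ψ (xs k)) ∧ Tendsto qs atTop (𝓝 q)}

end Convex

/-- A local minimizer of a minimization problem with objective `F`: a feasible point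
(`F x < ∞`) whose value is minimal in a neighbourhood. -/
def IsLocalMinimizer {X : Type*} [TopologicalSpace X] (F : X → EReal) (x : X) : Prop :=
  F x < ⊤ ∧ IsLocalMin F x

section Cardinality

variable {r : ℕ}

/-- The weighted count of nonzero entries. -/
def card0 (c : Fin r → ℝ) (u : Vec r) : EReal :=
  ((∑ i, if u i ≠ 0 then c i else 0 : ℝ) : EReal)

/-- The weighted count of positive entries. -/
def cardPos (c : Fin r → ℝ) (u : Vec r) : EReal :=
  ((∑ i, if 0 < u i then c i else 0 : ℝ) : EReal)

open Classical in
/-- The indicator function of a set, with values `0` and `∞`. -/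
def indic {X : Type*} (U : Set X) (x : X) : EReal := if x ∈ U then 0 else ⊤

/-- `Φ₀`. -/
def Phi0 (lam : Fin r → ℝ) : Vec r → EReal := card0 lam

/-- `Φ₊`. -/
def PhiPlus (lam : Fin r → ℝ) : Vec r → EReal := cardPos lam

/-- `Ψ₀`. -/
def Psi0 (mu : Fin r → ℝ) : Vec r → EReal := card0 mu

/-- `Ψ₊`. -/
def PsiPlus (mu : Fin r → ℝ) (z : Vec r) : EReal :=
  card0 mu z + indic {v : Vec r | ∀ i, 0 ≤ v i} z

end Cardinality

section Problems

variable {n m r : ℕ}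

/-- `Θ(x) = f(x) + g(Ax)`, the convex part of the primal objective. -/
def Theta (f : Vec n → EReal) (g : Vec m → EReal) (A : Matrix (Fin m) (Fin n) ℝ)
    (x : Vec n) : EReal :=
  f x + g (mv A x)

/-- `F(x) = Θ(x) + Φ(Bx - b)`, the objective of (P). -/
def primalObj (f : Vec n → EReal) (g : Vec m → EReal) (A : Matrix (Fin m) (Fin n) ℝ)
    (B : Matrix (Fin r) (Fin n) ℝ) (b : Vec r) (Φ : Vec r → EReal) (x : Vec n) : EReal :=
  Theta f g A x + Φ (mv B x - b)

/-- `Qᵀw = Aᵀy + Bᵀz` for `Q = [A; B]` and `w = [y; z]`. -/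
def QT (A : Matrix (Fin m) (Fin n) ℝ) (B : Matrix (Fin r) (Fin n) ℝ) (w : Vec m × Vec r) :
    Vec n :=
  mv A.transpose w.1 + mv B.transpose w.2

/-- `Ξ(w) = f*(-Qᵀw) + g*(y) + ⟨b, z⟩`, the convex part of the dual objective. -/
def Xi (f : Vec n → EReal) (g : Vec m → EReal) (A : Matrix (Fin m) (Fin n) ℝ)
    (B : Matrix (Fin r) (Fin n) ℝ) (b : Vec r) (w : Vec m × Vec r) : EReal :=
  conj f (-QT A B w) + conj g w.1 + ((inner ℝ b w.2 : ℝ) : EReal)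

/-- `G(w) = Ξ(w) + Ψ(z)`, the objective of (D). -/
def dualObj (f : Vec n → EReal) (g : Vec m → EReal) (A : Matrix (Fin m) (Fin n) ℝ)
    (B : Matrix (Fin r) (Fin n) ℝ) (b : Vec r) (Ψ : Vec r → EReal) (w : Vec m × Vec r) : EReal :=
  Xi f g A B b w + Ψ w.2

/-- Primal Slater condition at `xs` for `Φ₊`: the inequalities are imposed on the indices outside
the support of `B xs - b`. -/
def SlaterPPlus (f : Vec n → EReal) (g : Vec m → EReal) (A : Matrix (Fin m) (Fin n) ℝ)
    (B : Matrix (Fin r) (Fin n) ℝ) (b : Vec r) (xs : Vec n) : Prop :=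
  ∃ x : Vec n, x ∈ slaterDom f ∧ mv A x ∈ slaterDom g ∧
    ∀ i, (mv B xs - b) i = 0 → (mv B x - b) i ≤ 0

/-- Primal Slater condition at `xs` for `Φ₀`. -/
def SlaterP0 (f : Vec n → EReal) (g : Vec m → EReal) (A : Matrix (Fin m) (Fin n) ℝ)
    (B : Matrix (Fin r) (Fin n) ℝ) (b : Vec r) (xs : Vec n) : Prop :=
  ∃ x : Vec n, x ∈ slaterDom f ∧ mv A x ∈ slaterDom g ∧
    ∀ i, (mv B xs - b) i = 0 → (mv B x - b) i = 0

/-- Dual Slater condition at `ws = [ys; zs]` for `Ψ₊`: `z` vanishes outside the support of `zs`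
and is nonnegative on it. -/
def SlaterDPlus (f : Vec n → EReal) (g : Vec m → EReal) (A : Matrix (Fin m) (Fin n) ℝ)
    (B : Matrix (Fin r) (Fin n) ℝ) (ws : Vec m × Vec r) : Prop :=
  ∃ w : Vec m × Vec r, -QT A B w ∈ slaterDom (conj f) ∧ w.1 ∈ slaterDom (conj g) ∧
    (∀ i, ws.2 i = 0 → w.2 i = 0) ∧ (∀ i, ws.2 i ≠ 0 → 0 ≤ w.2 i)

/-- Dual Slater condition at `ws = [ys; zs]` for `Ψ₀`. -/
def SlaterD0 (f : Vec n → EReal) (g : Vec m → EReal) (A : Matrix (Fin m) (Fin n) ℝ)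
    (B : Matrix (Fin r) (Fin n) ℝ) (ws : Vec m × Vec r) : Prop :=
  ∃ w : Vec m × Vec r, -QT A B w ∈ slaterDom (conj f) ∧ w.1 ∈ slaterDom (conj g) ∧
    (∀ i, ws.2 i = 0 → w.2 i = 0)

end Problems

end CCOP

end

open CCOP

/-!
Near `x`, the count `Φ(B x' - b)` does not increase as long as no entry that vanishes at `x` is
switched on. So a local minimizer `x` of the primal problem is a local, hence global, minimizer of the convex function `Θ` subject to sign constraints
`B x - b ∈ U` on the entries that vanish at `x`; the dual problem reduces in the same way to `Ξ` and
a cone `V`. Convex duality gives multipliers for these reduced problems. In both directions the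
outcome is a pair with equal convex values `Θ(x) = -Ξ(w)` that is *complementary*: at each index one
of `u = B x - b` and `z` vanishes (and `z ≥ 0` for the pair `Φ₊`, `Ψ₊`).

Complementarity implies `Ψ(z) + ⟨u, z'⟩ ≤ Ψ(z')` for `z'` near `z` and `Φ(u) + ⟨z, u'⟩ ≤ Φ(u')` for
`u'` near `u` (`card0_eventually`, `cardPos_eventually`): at an index where the entry is zero, the
jump of the count dominates the small linear term. The second inequality makes `z` a subgradient of
`Φ` at `u`. Weak duality reads `Ξ(w') ≥ -Θ(x) - ⟨u, z'⟩`, so that adding the first inequality gives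
`Ξ(w') + Ψ(z') ≥ Ξ(w) + Ψ(z)` near `w`; the local optimality of `x` in the other direction is obtained
symmetrically (`primal_to_dual`, `dual_to_primal`).

The multipliers under the mixed Slater condition (polyhedral pieces need only a feasible point, the
others a relative interior point) come from `exists_multiplier_finset`: an affine function that is
nonnegative on `K ∩ P`, with `K` convex and `P` a polyhedron meeting the relative interior of `K`,
becomes nonnegative on `K` after adding an affine function that is nonpositive on `P`. It is
proved by induction on the number of constraints, and is applied to products of epigraphs, a
polyhedral epigraph being part of `P` (`SlaterSet`). In the dual-to-primal direction the
Fenchel–Moreau theorem `ProperLscConvex.le_of_forall_conj` returns from the conjugates to `f` and `g`.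
-/

namespace CCOP

/-! ### Lagrange multipliers for affine constraints -/

section Multipliers

variable {V W : Type*} [AddCommGroup V] [Module ℝ V] [AddCommGroup W] [Module ℝ W]

/-- `x` belongs to the algebraic relative interior of `K`: every segment from a point of `K` to `x`
can be prolonged beyond `x` inside `K`. For convex sets in finite dimension this is the usual relative
interior, but no topology is involved. -/
def RelCore (K : Set V) (x : V) : Prop :=
  x ∈ K ∧ ∀ v ∈ K, ∃ ε : ℝ, 0 < ε ∧ x + ε • (x - v) ∈ K

lemma affine_prolong (a : V →ᵃ[ℝ] W) (x v : V) (ε : ℝ) :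
    a (x + ε • (x - v)) = a x + ε • (a x - a v) := by
  have h := a.map_vadd x (ε • (x - v))
  have h2 := a.linearMap_vsub x v
  simp only [vadd_eq_add, vsub_eq_sub, map_smul] at h h2
  rw [add_comm, h, h2, add_comm]

lemma RelCore.inter_affine_eq {K : Set V} {x : V} (hx : RelCore K x) (a : V →ᵃ[ℝ] W)
    (ha : a x = 0) : RelCore (K ∩ {v | a v = 0}) x := by
  refine ⟨⟨hx.1, ha⟩, fun v hv => ?_⟩
  obtain ⟨ε, hε, h⟩ := hx.2 v hv.1
  have h0 : a v = 0 := hv.2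
  exact ⟨ε, hε, h, by simp [affine_prolong, ha, h0]⟩

lemma RelCore.prolong_le {K : Set V} (hK : Convex ℝ K) {x v : V} (hx : RelCore K x) (hv : v ∈ K) :
    ∃ ε : ℝ, 0 < ε ∧ ∀ δ : ℝ, 0 ≤ δ → δ ≤ ε → x + δ • (x - v) ∈ K := by
  obtain ⟨ε, hε, h⟩ := hx.2 v hv
  refine ⟨ε, hε, fun δ h0 h1 => ?_⟩
  have := hK hx.1 h (sub_nonneg.2 ((div_le_one hε).2 h1)) (div_nonneg h0 hε.le) (by ring)
  convert this using 1
  rw [smul_add, ← add_assoc, ← add_smul, smul_smul, div_mul_cancel₀ _ hε.ne']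
  simp

lemma RelCore.inter_affine_lt {K : Set V} (hK : Convex ℝ K) {x : V} (hx : RelCore K x)
    (a : V →ᵃ[ℝ] ℝ) (ha : a x < 0) : RelCore (K ∩ {v | a v ≤ 0}) x := by
  refine ⟨⟨hx.1, ha.le⟩, fun v hv => ?_⟩
  obtain ⟨ε, hε, h⟩ := hx.prolong_le hK hv.1
  have hd : 0 < |a x - a v| + 1 := by positivity
  refine ⟨min ε (-a x / (|a x - a v| + 1)), lt_min hε (div_pos (neg_pos.2 ha) hd),
    h _ (le_min hε.le (div_pos (neg_pos.2 ha) hd).le) (min_le_left _ _), ?_⟩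
  set δ := min ε (-a x / (|a x - a v| + 1)) with hδ
  have h0 : 0 ≤ δ := le_min hε.le (div_pos (neg_pos.2 ha) hd).le
  have h1 : δ * (|a x - a v| + 1) ≤ -a x := (le_div_iff₀ hd).1 (min_le_right _ _)
  have h2 := mul_le_mul_of_nonneg_left (le_abs_self (a x - a v)) h0
  simp only [Set.mem_ofPred_eq, affine_prolong, smul_eq_mul]
  nlinarith

lemma RelCore.midpoint {K : Set V} (hK : Convex ℝ K) {x y : V} (hx : RelCore K x) (hy : y ∈ K) :
    RelCore K ((1 / 2 : ℝ) • x + (1 / 2 : ℝ) • y) := by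
  refine ⟨hK hx.1 hy (by norm_num) (by norm_num) (by norm_num), fun v hv => ?_⟩
  obtain ⟨ε, hε, h⟩ := hx.2 v hv
  -- The new point is prolonged away from `v` by mixing the prolongation of `x` with `y`.
  refine ⟨ε / (2 + ε), by positivity, ?_⟩
  have h2 : (2 + ε) ≠ 0 := by positivity
  have := hK h hy (a := 1 / (2 + ε)) (b := (1 + ε) / (2 + ε)) (by positivity) (by positivity)
    (by field_simp; ring)
  convert this using 1
  match_scalars <;> field_simp <;> ring

lemma affine_combo (a : V →ᵃ[ℝ] ℝ) {x y : V} {s t : ℝ} (h : s + t = 1) :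
    a (s • x + t • y) = s * a x + t * a y := by
  rw [Convex.combo_affine_apply h]; simp

/-- If `ℓ ≥ 0` on `K ∩ {a = 0}`, the slopes `-ℓ / a` on the side `a > 0` of `K` lie below those on
the side `a < 0`: the segment between two such points meets `{a = 0}`. -/
lemma slope_le_slope {K : Set V} (hK : Convex ℝ K) {a ℓ : V →ᵃ[ℝ] ℝ}
    (h : ∀ v ∈ K, a v = 0 → 0 ≤ ℓ v) {v w : V} (hv : v ∈ K) (hav : 0 < a v) (hw : w ∈ K)
    (haw : a w < 0) : -ℓ v / a v ≤ ℓ w / -a w := by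
  have hd : 0 < a v - a w := by linarith
  have hst : -a w / (a v - a w) + a v / (a v - a w) = 1 := by field_simp; ring
  have hm := hK hv hw (a := -a w / (a v - a w)) (b := a v / (a v - a w))
    (div_nonneg (by linarith) hd.le) (div_nonneg hav.le hd.le) hst
  have h1 := h _ hm (by rw [affine_combo a hst]; field_simp; ring)
  rw [affine_combo ℓ hst, show -a w / (a v - a w) * ℓ v + a v / (a v - a w) * ℓ w
    = (-a w * ℓ v + a v * ℓ w) / (a v - a w) by ring] at h1
  have h2 : 0 ≤ -a w * ℓ v + a v * ℓ w := by
    have := mul_nonneg h1 hd.le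
    rwa [div_mul_cancel₀ _ hd.ne'] at this
  rw [div_le_div_iff₀ hav (by linarith)]
  linarith

/-- A Lagrange multiplier for one affine equality. The multiplier separates the slopes `-ℓ / a` at
the points with `a > 0` from those at the points with `a < 0`. -/
lemma exists_multiplier_eq {K : Set V} (hK : Convex ℝ K) {x : V} (hx : RelCore K x)
    (a ℓ : V →ᵃ[ℝ] ℝ) (ha : a x = 0) (h : ∀ v ∈ K, a v = 0 → 0 ≤ ℓ v) :
    ∃ κ : ℝ, ∀ v ∈ K, 0 ≤ ℓ v + κ * a v := by
  by_cases hpos : ∃ v ∈ K, 0 < a v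
  · obtain ⟨v₀, hv₀, hav₀⟩ := hpos
    obtain ⟨ε, hε, hw₀⟩ := hx.2 v₀ hv₀
    set w₀ := x + ε • (x - v₀)
    have haw₀ : a w₀ < 0 := by
      simp only [w₀, affine_prolong, ha, smul_eq_mul]; nlinarith
    have hbdd : BddAbove ((fun v => -ℓ v / a v) '' {v | v ∈ K ∧ 0 < a v}) :=
      ⟨ℓ w₀ / -a w₀, by rintro _ ⟨v, ⟨hv, hav⟩, rfl⟩; exact slope_le_slope hK h hv hav hw₀ haw₀⟩
    refine ⟨sSup ((fun v => -ℓ v / a v) '' {v | v ∈ K ∧ 0 < a v}), fun v hv => ?_⟩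
    rcases lt_trichotomy (a v) 0 with hav | hav | hav
    · have := csSup_le (s := (fun v => -ℓ v / a v) '' {v | v ∈ K ∧ 0 < a v})
        ⟨_, v₀, ⟨hv₀, hav₀⟩, rfl⟩
        (by rintro _ ⟨u, ⟨hu, hau⟩, rfl⟩; exact slope_le_slope hK h hu hau hv hav)
      rw [le_div_iff₀ (by linarith)] at this
      linarith
    · rw [hav, mul_zero, add_zero]; exact h v hv hav
    · have := le_csSup hbdd ⟨v, ⟨hv, hav⟩, rfl⟩
      rw [div_le_iff₀ hav] at this
      linarith
  · push Not at hpos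
    -- `a ≤ 0` on `K` with equality at `x`, so `a` vanishes on `K`.
    refine ⟨0, fun v hv => ?_⟩
    obtain ⟨ε, hε, hw⟩ := hx.2 v hv
    have h1 := hpos _ hw
    simp only [affine_prolong, ha, smul_eq_mul] at h1
    have h2 : a v = 0 := le_antisymm (hpos v hv) (by nlinarith)
    simpa using h v hv h2

/-- A Lagrange multiplier for one affine inequality that holds strictly at a point. -/
lemma exists_multiplier_lt {K : Set V} (hK : Convex ℝ K) {x : V} (hx : x ∈ K)
    (a ℓ : V →ᵃ[ℝ] ℝ) (ha : a x < 0) (h : ∀ v ∈ K, a v ≤ 0 → 0 ≤ ℓ v) :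
    ∃ κ : ℝ, 0 ≤ κ ∧ ∀ v ∈ K, 0 ≤ ℓ v + κ * a v := by
  -- The supremum runs over the slopes together with `0`, which makes it nonnegative.
  set T : Set ℝ := insert 0 ((fun v => -ℓ v / a v) '' {v | v ∈ K ∧ 0 < a v})
  have hle : ∀ w ∈ K, a w < 0 → ∀ τ ∈ T, τ ≤ ℓ w / -a w := by
    rintro w hw haw τ (rfl | ⟨v, ⟨hv, hav⟩, rfl⟩)
    · exact div_nonneg (h w hw haw.le) (by linarith)
    · exact slope_le_slope hK (fun v hv hav => h v hv hav.le) hv hav hw haw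
  have hbdd : BddAbove T := ⟨_, fun τ hτ => hle x hx ha τ hτ⟩
  refine ⟨sSup T, le_csSup hbdd (Set.mem_insert _ _), fun v hv => ?_⟩
  rcases lt_trichotomy (a v) 0 with hav | hav | hav
  · have := csSup_le (s := T) ⟨0, Set.mem_insert _ _⟩ (hle v hv hav)
    rw [le_div_iff₀ (by linarith)] at this
    linarith
  · rw [hav, mul_zero, add_zero]; exact h v hv hav.le
  · have := le_csSup hbdd (Set.mem_insert_of_mem _ ⟨v, ⟨hv, hav⟩, rfl⟩)
    rw [div_le_iff₀ hav] at this
    linarith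

/-- Lagrange multipliers for finitely many affine inequalities, under the weak Slater condition that
a feasible point lies in the relative interior of `K`. The function `c` plays the role of the
weighted sum of the constraints; only its sign on the feasible set matters. -/
lemma exists_multiplier_finset (s : Finset (V →ᵃ[ℝ] ℝ)) :
    ∀ {K : Set V}, Convex ℝ K → ∀ {x : V}, RelCore K x → (∀ a ∈ s, a x ≤ 0) →
      ∀ ℓ : V →ᵃ[ℝ] ℝ, (∀ v ∈ K, (∀ a ∈ s, a v ≤ 0) → 0 ≤ ℓ v) →
      ∃ c : V →ᵃ[ℝ] ℝ, (∀ v, (∀ a ∈ s, a v ≤ 0) → c v ≤ 0) ∧ ∀ v ∈ K, 0 ≤ ℓ v + c v := by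
  classical
  induction s using Finset.induction_on with
  | empty =>
    intro K _ x _ _ ℓ h
    exact ⟨0, by simp, fun v hv => by simpa using h v hv (by simp)⟩
  | insert a s _ ih =>
    intro K hK x hx hs ℓ h
    simp only [Finset.forall_mem_insert] at hs h ⊢
    by_cases hstrict : ∃ y ∈ K, a y < 0 ∧ ∀ a' ∈ s, a' y ≤ 0
    · -- The constraint `a` can be made strict at a relative interior point.
      obtain ⟨y, hy, hay, hsy⟩ := hstrict
      have h12 : (1 / 2 : ℝ) + 1 / 2 = 1 := by norm_num
      have hm := hx.midpoint hK hy
      have ham : a ((1 / 2 : ℝ) • x + (1 / 2 : ℝ) • y) < 0 := by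
        rw [affine_combo a h12]; linarith [hs.1]
      have hsm : ∀ a' ∈ s, a' ((1 / 2 : ℝ) • x + (1 / 2 : ℝ) • y) ≤ 0 := by
        intro a' ha'
        rw [affine_combo a' h12]; linarith [hs.2 a' ha', hsy a' ha']
      have hconv : Convex ℝ (K ∩ {v | a v ≤ 0}) :=
        hK.inter (by simpa [Set.preimage] using (convex_Iic (0 : ℝ)).affine_preimage a)
      obtain ⟨c, hc, hcK⟩ := ih hconv (hm.inter_affine_lt hK a ham) hsm ℓ
        (fun v hv hsv => h v hv.1 ⟨hv.2, hsv⟩)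
      obtain ⟨κ, hκ, hκK⟩ := exists_multiplier_lt hK hm.1 a (ℓ + c) ham
        (fun v hv hav => by simpa using hcK v ⟨hv, hav⟩)
      refine ⟨c + κ • a, fun v hv => ?_, fun v hv => ?_⟩
      · have := mul_nonpos_of_nonneg_of_nonpos hκ hv.1
        simpa using add_nonpos (hc v hv.2) this
      · simpa [add_assoc] using hκK v hv
    · -- Feasible points satisfy `a = 0`: that equality is absorbed into `K`, and the sign of its
      -- multiplier is repaired by the multipliers which certify `a ≥ 0`.
      push Not at hstrict
      have hnn : ∀ v ∈ K, (∀ a' ∈ s, a' v ≤ 0) → 0 ≤ a v := by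
        intro v hv hsv
        by_contra hlt
        obtain ⟨a', ha', hlt'⟩ := hstrict v hv (not_le.1 hlt)
        exact absurd (hsv a' ha') (not_le.2 hlt')
      have hax : a x = 0 := le_antisymm hs.1 (hnn x hx.1 hs.2)
      have hconv : Convex ℝ (K ∩ {v | a v = 0}) :=
        hK.inter (by simpa [Set.preimage] using (convex_singleton (0 : ℝ)).affine_preimage a)
      obtain ⟨c, hc, hcK⟩ := ih hconv (hx.inter_affine_eq a hax) hs.2 ℓ
        (fun v hv hsv => h v hv.1 ⟨le_of_eq hv.2, hsv⟩)
      obtain ⟨κ, hκK⟩ := exists_multiplier_eq hK hx a (ℓ + c) hax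
        (fun v hv hav => by simpa using hcK v ⟨hv, hav⟩)
      rcases le_total 0 κ with hκ | hκ
      · refine ⟨c + κ • a, fun v hv => ?_, fun v hv => ?_⟩
        · have := mul_nonpos_of_nonneg_of_nonpos hκ hv.1
          simpa using add_nonpos (hc v hv.2) this
        · simpa [add_assoc] using hκK v hv
      · obtain ⟨d, hd, hdK⟩ := ih hK hx hs.2 a hnn
        refine ⟨c + (-κ) • d, fun v hv => ?_, fun v hv => ?_⟩
        · have := mul_nonpos_of_nonneg_of_nonpos (neg_nonneg.2 hκ) (hd v hv.2)
          simpa using add_nonpos (hc v hv.2) this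
        · have h1 := hκK v hv
          have h2 := mul_nonneg (neg_nonneg.2 hκ) (hdK v hv)
          simp only [AffineMap.coe_add, Pi.add_apply, AffineMap.coe_smul, Pi.smul_apply,
            smul_eq_mul] at h1 ⊢
          linarith

lemma affine_sum_apply {ι : Type*} (s : Finset ι) (M : ι → V →ᵃ[ℝ] ℝ) (v : V) :
    (∑ i ∈ s, M i) v = ∑ i ∈ s, M i v := by
  classical
  induction s using Finset.induction_on with
  | empty => simp
  | insert i s hi ih => simp [Finset.sum_insert hi, ih]

/-- Lagrange multipliers for finitely many affine equalities. -/
lemma exists_multiplier_eq_finset {ι : Type*} (s : Finset ι) (M : ι → V →ᵃ[ℝ] ℝ) :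
    ∀ {K : Set V}, Convex ℝ K → ∀ {x : V}, RelCore K x → (∀ i ∈ s, M i x = 0) →
      ∀ ℓ : V →ᵃ[ℝ] ℝ, (∀ v ∈ K, (∀ i ∈ s, M i v = 0) → 0 ≤ ℓ v) →
      ∃ κ : ι → ℝ, ∀ v ∈ K, 0 ≤ ℓ v + ∑ i ∈ s, κ i * M i v := by
  classical
  induction s using Finset.induction_on with
  | empty =>
    intro K _ x _ _ ℓ h
    exact ⟨0, fun v hv => by simpa using h v hv (by simp)⟩
  | insert j s hj ih =>
    intro K hK x hx hs ℓ h
    simp only [Finset.forall_mem_insert] at hs h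
    have hconv : Convex ℝ (K ∩ {v | M j v = 0}) :=
      hK.inter (by simpa [Set.preimage] using (convex_singleton (0 : ℝ)).affine_preimage (M j))
    obtain ⟨κ, hκ⟩ := ih hconv (hx.inter_affine_eq (M j) hs.1) hs.2 ℓ
      (fun v hv hsv => h v hv.1 ⟨hv.2, hsv⟩)
    obtain ⟨τ, hτ⟩ := exists_multiplier_eq hK hx (M j) (ℓ + ∑ i ∈ s, κ i • M i) hs.1
      (fun v hv hav => by
        have := hκ v ⟨hv, hav⟩
        simpa [affine_sum_apply] using this)
    refine ⟨Function.update κ j τ, fun v hv => ?_⟩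
    have h1 := hτ v hv
    have h2 : (∑ i ∈ s, κ i • M i) v = ∑ i ∈ s, Function.update κ j τ i * M i v := by
      have : ∀ i ∈ s, Function.update κ j τ i = κ i := fun i hi =>
        Function.update_of_ne (by rintro rfl; exact hj hi) _ _
      rw [affine_sum_apply]
      exact Finset.sum_congr rfl fun i hi => by simp [this i hi]
    rw [Finset.sum_insert hj, Function.update_self]
    rw [AffineMap.coe_add, Pi.add_apply, h2] at h1
    linarith

/-- `S` is the intersection of a convex set with finitely many affine half-spaces, and `x` is a
point of `S` in the relative interior of the convex set. -/
def SlaterSet (S : Set V) (x : V) : Prop :=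
  ∃ (K : Set V) (s : Finset (V →ᵃ[ℝ] ℝ)), Convex ℝ K ∧ RelCore K x ∧ (∀ a ∈ s, a x ≤ 0) ∧
    S = K ∩ {v | ∀ a ∈ s, a v ≤ 0}

lemma SlaterSet.convex {S : Set V} {x : V} (h : SlaterSet S x) : Convex ℝ S := by
  obtain ⟨K, s, hK, -, -, rfl⟩ := h
  refine hK.inter ?_
  have : {v | ∀ a ∈ s, a v ≤ 0} = ⋂ a ∈ s, (a ⁻¹' Set.Iic (0 : ℝ)) := by ext; simp
  rw [this]
  exact convex_iInter₂ fun a _ => (convex_Iic (0 : ℝ)).affine_preimage a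

lemma SlaterSet.prod {S : Set V} {T : Set W} {x : V} {y : W} (hS : SlaterSet S x)
    (hT : SlaterSet T y) : SlaterSet (S ×ˢ T) (x, y) := by
  classical
  obtain ⟨K, s, hK, hx, hsx, rfl⟩ := hS
  obtain ⟨L, t, hL, hy, hty, rfl⟩ := hT
  refine ⟨K ×ˢ L, s.image (fun a => a.comp AffineMap.fst) ∪ t.image (fun a => a.comp AffineMap.snd),
    hK.prod hL, ⟨⟨hx.1, hy.1⟩, ?_⟩, ?_, ?_⟩
  · rintro ⟨v, w⟩ ⟨hv, hw⟩
    obtain ⟨ε, hε, h1⟩ := hx.prolong_le hK hv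
    obtain ⟨δ, hδ, h2⟩ := hy.prolong_le hL hw
    have h0 := lt_min hε hδ
    exact ⟨min ε δ, h0, h1 _ h0.le (min_le_left _ _), h2 _ h0.le (min_le_right _ _)⟩
  · intro a ha
    rcases Finset.mem_union.1 ha with h | h
    · obtain ⟨a, h', rfl⟩ := Finset.mem_image.1 h
      exact hsx a h'
    · obtain ⟨a, h', rfl⟩ := Finset.mem_image.1 h
      exact hty a h'
  · ext ⟨v, w⟩
    simp only [Set.mem_prod, Set.mem_inter_iff, Set.mem_ofPred_eq, Finset.mem_union,
      Finset.mem_image]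
    constructor
    · rintro ⟨⟨h1, h2⟩, h3, h4⟩
      refine ⟨⟨h1, h3⟩, ?_⟩
      rintro _ (⟨a, ha, rfl⟩ | ⟨a, ha, rfl⟩)
      · exact h2 a ha
      · exact h4 a ha
    · rintro ⟨⟨h1, h3⟩, h⟩
      exact ⟨⟨h1, fun a ha => h _ (Or.inl ⟨a, ha, rfl⟩)⟩,
        h3, fun a ha => h _ (Or.inr ⟨a, ha, rfl⟩)⟩

/-- A polyhedron satisfies the Slater condition at each of its points. -/
lemma slaterSet_of_finite {ι : Type*} [Finite ι] (a : ι → V →ᵃ[ℝ] ℝ) {x : V}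
    (hx : ∀ i, a i x ≤ 0) : SlaterSet {v | ∀ i, a i v ≤ 0} x := by
  classical
  have := Fintype.ofFinite ι
  refine ⟨Set.univ, Finset.univ.image a, convex_univ, ⟨trivial, fun _ _ => ⟨1, one_pos, trivial⟩⟩,
    by simpa using hx, by ext; simp⟩

/-- Under the Slater condition, a local minimizer of an affine function on `S ∩ {M = 0}` minimizes
a Lagrangian on the whole of `S`. -/
lemma SlaterSet.exists_lagrangian [TopologicalSpace V] [IsTopologicalAddGroup V]
    [ContinuousSMul ℝ V] [FiniteDimensional ℝ W] {S : Set V} {x : V}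
    (hS : SlaterSet S x) (M : V →ᵃ[ℝ] W) (hx : M x = 0) (ℓ : V →ᵃ[ℝ] ℝ) {v₀ : V} (hv₀ : v₀ ∈ S)
    (hM : M v₀ = 0) (hmin : ∀ᶠ v in 𝓝 v₀, v ∈ S → M v = 0 → ℓ v₀ ≤ ℓ v) :
    ∃ κ : W →ₗ[ℝ] ℝ, ∀ v ∈ S, ℓ v₀ ≤ ℓ v + κ (M v) := by
  have hglob : ∀ v ∈ S, M v = 0 → ℓ v₀ ≤ ℓ v := by
    have hconv : Convex ℝ (S ∩ M ⁻¹' {0}) :=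
      hS.convex.inter ((convex_singleton (0 : W)).affine_preimage M)
    have hloc : IsLocalMinOn ℓ (S ∩ M ⁻¹' {0}) v₀ := by
      refine eventually_nhdsWithin_iff.2 ?_
      filter_upwards [hmin] with v h hv using h hv.1 hv.2
    have hcv : ConvexOn ℝ (S ∩ M ⁻¹' {0}) ℓ :=
      ⟨hconv, fun x _ y _ s t _ _ hst => by rw [affine_combo ℓ hst]; rfl⟩
    intro v hv hMv
    exact IsMinOn.of_isLocalMinOn_of_convexOn (Set.mem_inter hv₀ hM) hloc hcv (Set.mem_inter hv hMv)
  obtain ⟨K, s, hK, hxK, hsx, rfl⟩ := hS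
  have hconv : Convex ℝ (K ∩ {v | M v = 0}) :=
    hK.inter (by simpa [Set.preimage] using (convex_singleton (0 : W)).affine_preimage M)
  obtain ⟨c, hc, hcK⟩ := exists_multiplier_finset s hconv (hxK.inter_affine_eq M hx) hsx
    (ℓ - AffineMap.const ℝ V (ℓ v₀)) (fun v hv hsv => by
      simpa using hglob v ⟨hv.1, hsv⟩ hv.2)
  let β := Module.finBasis ℝ W
  have hβ : ∀ v, (∀ i ∈ Finset.univ, ((β.coord i).toAffineMap.comp M) v = 0) → M v = 0 := by
    intro v h
    exact β.ext_elem fun i => by simpa using h i (Finset.mem_univ i)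
  obtain ⟨κ, hκ⟩ := exists_multiplier_eq_finset Finset.univ
    (fun i => (β.coord i).toAffineMap.comp M) hK hxK (fun i _ => by simp [hx])
    ((ℓ - AffineMap.const ℝ V (ℓ v₀)) + c) (fun v hv h => by
      simpa using hcK v ⟨hv, hβ v h⟩)
  refine ⟨∑ i, κ i • β.coord i, fun v hv => ?_⟩
  have h1 := hκ v hv.1
  have h2 := hc v hv.2
  simp at h1 ⊢
  linarith

end Multipliers


/-! ### Epigraphs, relative interiors and conjugates -/

section Epigraph

lemma exists_mem_epi {X : Type*} {ψ : X → EReal} {x : X} (hx : x ∈ dom ψ) :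
    ∃ t : ℝ, (x, t) ∈ epi ψ := by
  obtain ⟨t, ht, -⟩ := EReal.lt_iff_exists_real_btwn.1 (show ψ x < ⊤ from hx)
  exact ⟨t, ht.le⟩

lemma isClosed_epi {X : Type*} [TopologicalSpace X] {ψ : X → EReal}
    (hψ : LowerSemicontinuous ψ) : IsClosed (epi ψ) :=
  hψ.isClosed_epigraph.preimage
    (f := fun p : X × ℝ => (p.1, (p.2 : EReal)))
    (continuous_fst.prodMk (continuous_coe_real_ereal.comp continuous_snd))

variable {E : Type*} [NormedAddCommGroup E] [InnerProductSpace ℝ E]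

lemma relCore_of_mem_intrinsicInterior {D : Set E} {x : E} (hx : x ∈ intrinsicInterior ℝ D) :
    RelCore D x := by
  refine ⟨intrinsicInterior_subset hx, fun v hv => ?_⟩
  obtain ⟨y, hy, rfl⟩ := mem_intrinsicInterior.1 hx
  have hmem : ∀ ε : ℝ, (y : E) + ε • ((y : E) - v) ∈ affineSpan ℝ D := by
    intro ε
    have := AffineMap.lineMap_mem (1 + ε) (subset_affineSpan ℝ D hv) y.2
    convert this using 1
    rw [AffineMap.lineMap_apply_module]
    match_scalars <;> ring
  let γ : ℝ → affineSpan ℝ D := fun ε => ⟨(y : E) + ε • ((y : E) - v), hmem ε⟩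
  have hγ : Continuous γ := by
    apply Continuous.subtype_mk
    fun_prop
  have h0 : γ 0 = y := by ext; simp [γ]
  have hnhds : ∀ᶠ ε in 𝓝 (0 : ℝ), γ ε ∈ interior ((↑) ⁻¹' D : Set (affineSpan ℝ D)) := by
    apply hγ.continuousAt.eventually_mem
    rw [h0]
    exact isOpen_interior.mem_nhds hy
  obtain ⟨ε, hε, hpos⟩ :=
    ((hnhds.filter_mono nhdsWithin_le_nhds).and (self_mem_nhdsWithin (s := Set.Ioi (0 : ℝ)))).exists
  have hD : γ ε ∈ ((↑) ⁻¹' D : Set (affineSpan ℝ D)) := interior_subset hε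
  exact ⟨ε, hpos, hD⟩

/-- A point over the relative interior of the domain and strictly above the graph is in the relative
interior of the epigraph. -/
lemma relCore_epi {ψ : E → EReal} (hψ : Convex ℝ (epi ψ)) {x : E} (hx : RelCore (dom ψ) x)
    {t₀ t : ℝ} (h₀ : (x, t₀) ∈ epi ψ) (ht : t₀ < t) : RelCore (epi ψ) (x, t) := by
  refine ⟨le_trans (show ψ x ≤ t₀ from h₀) (EReal.coe_le_coe_iff.2 ht.le), ?_⟩
  rintro ⟨v, s⟩ hv
  obtain ⟨ε, hε, hd⟩ := hx.2 v (lt_of_le_of_lt (show ψ v ≤ s from hv) (EReal.coe_lt_top s))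
  obtain ⟨m, hm⟩ := exists_mem_epi hd
  -- A small step `θ` towards the prolonged point costs less height than the gap `t - t₀`.
  set C := |m - t₀ - ε * (t - s)| with hC
  have hgap : 0 < t - t₀ := by linarith
  have hCn : 0 ≤ C := abs_nonneg _
  set θ := (t - t₀) / (t - t₀ + C) with hθ
  have hθ0 : 0 < θ := by positivity
  have hθ1 : θ ≤ 1 := (div_le_one (by positivity)).2 (by linarith)
  have hθC : θ * C ≤ t - t₀ := by
    rw [hθ, div_mul_eq_mul_div, div_le_iff₀ (by positivity)]
    nlinarith
  have hc := hψ h₀ hm (sub_nonneg.2 hθ1) hθ0.le (by ring)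
  refine ⟨θ * ε, by positivity, ?_⟩
  have hpt : (1 - θ) • x + θ • (x + ε • (x - v)) = x + (θ * ε) • (x - v) := by
    match_scalars <;> ring
  simp only [epi, Set.mem_ofPred_eq, Prod.smul_mk, Prod.mk_add_mk, Prod.mk_sub_mk, smul_eq_mul,
    hpt] at hc ⊢
  refine hc.trans (EReal.coe_le_coe_iff.2 ?_)
  have := mul_le_mul_of_nonneg_left (le_abs_self (m - t₀ - ε * (t - s))) hθ0.le
  nlinarith

lemma exists_slaterSet_epi {ψ : E → EReal} (hψ : Convex ℝ (epi ψ)) {x : E}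
    (hx : x ∈ slaterDom ψ) : ∃ t : ℝ, SlaterSet (epi ψ) (x, t) := by
  rcases hx with hx | ⟨⟨k, a, α, β, h⟩, hx⟩
  · have hc := relCore_of_mem_intrinsicInterior hx
    obtain ⟨t, ht⟩ := exists_mem_epi hc.1
    exact ⟨t + 1, epi ψ, ∅, hψ, relCore_epi hψ hc ht (by linarith), by simp, by simp⟩
  · obtain ⟨t, ht⟩ := exists_mem_epi hx
    let c : Fin k → (E × ℝ) →ᵃ[ℝ] ℝ := fun i =>
      (((innerₛₗ ℝ (a i)).comp (LinearMap.fst ℝ E ℝ)) +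
        α i • LinearMap.snd ℝ E ℝ).toAffineMap - AffineMap.const ℝ _ (β i)
    have hepi : epi ψ = {p | ∀ i, c i p ≤ 0} := by
      rw [h]; ext p; simp [c]
    refine ⟨t, ?_⟩
    rw [hepi] at ht ⊢
    exact slaterSet_of_finite c ht

/-- Bounds of the conjugate in terms of real numbers only, through the epigraph. -/
lemma mem_epi_conj {ψ : E → EReal} {q : E} {s : ℝ} :
    (q, s) ∈ epi (conj ψ) ↔ ∀ p ∈ epi ψ, inner ℝ q p.1 - p.2 ≤ s := by
  simp only [epi, conj, Set.mem_ofPred_eq, iSup_le_iff, Prod.forall]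
  refine forall_congr' fun x => ?_
  induction ψ x with
  | bot =>
    constructor
    · intro h; simp at h
    · intro h
      have := h (inner ℝ q x - s - 1) bot_le
      linarith
  | top => simp
  | coe a =>
    norm_cast
    exact ⟨fun h t ht => by linarith, fun h => h a le_rfl⟩

lemma conj_le_coe_iff {ψ : E → EReal} {q : E} {s : ℝ} :
    conj ψ q ≤ s ↔ ∀ p ∈ epi ψ, inner ℝ q p.1 - p.2 ≤ s := mem_epi_conj

lemma convex_epi_conj (ψ : E → EReal) : Convex ℝ (epi (conj ψ)) := by
  rintro ⟨q, s⟩ h1 ⟨q', s'⟩ h2 α β hα hβ hαβ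
  refine mem_epi_conj.2 fun p hp => ?_
  have e1 := mul_le_mul_of_nonneg_left (mem_epi_conj.1 h1 p hp) hα
  have e2 := mul_le_mul_of_nonneg_left (mem_epi_conj.1 h2 p hp) hβ
  simp only [Prod.smul_mk, inner_add_left, real_inner_smul_left, smul_eq_mul]
  have e3 : p.2 = α * p.2 + β * p.2 := by rw [← add_mul, hαβ, one_mul]
  linarith

lemma ProperLscConvex.exists_coe {ψ : E → EReal} (hψ : ProperLscConvex ψ) {x : E}
    (hx : ψ x < ⊤) : ∃ a : ℝ, ψ x = a :=
  ⟨(ψ x).toReal, (EReal.coe_toReal hx.ne (hψ.ne_bot x)).symm⟩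

lemma conj_ne_bot {ψ : E → EReal} (hψ : ProperLscConvex ψ) (q : E) : conj ψ q ≠ ⊥ := by
  obtain ⟨x, hx⟩ := hψ.dom_nonempty
  obtain ⟨a, ha⟩ := hψ.exists_coe hx
  refine ne_bot_of_le_ne_bot ?_ (le_iSup (fun x => ((inner ℝ q x : ℝ) : EReal) - ψ x) x)
  rw [ha]
  exact EReal.coe_ne_bot (inner ℝ q x - a)

/-- The Fenchel-Young inequality. -/
lemma inner_sub_le_conj (ψ : E → EReal) {x : E} {a : ℝ} (hx : ψ x = a) (q : E) :
    ((inner ℝ q x - a : ℝ) : EReal) ≤ conj ψ q := by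
  refine le_trans (le_of_eq ?_) (le_iSup (fun x => ((inner ℝ q x : ℝ) : EReal) - ψ x) x)
  simp [hx]

variable [CompleteSpace E]

/-- A point below the graph is separated from the epigraph. -/
lemma ProperLscConvex.exists_separation {ψ : E → EReal} (hψ : ProperLscConvex ψ) {x : E} {γ : ℝ}
    (h : (x, γ) ∉ epi ψ) : ∃ (p : E) (τ u : ℝ), inner ℝ p x + τ * γ < u ∧
      ∀ w ∈ epi ψ, u < inner ℝ p w.1 + τ * w.2 := by
  obtain ⟨L, u, h1, h2⟩ := geometric_hahn_banach_point_closed hψ.convex (isClosed_epi hψ.lsc) h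
  have hL : ∀ w : E × ℝ, L w =
      inner ℝ ((InnerProductSpace.toDual ℝ E).symm (L.comp (.inl ℝ E ℝ))) w.1 +
        L (0, 1) * w.2 := by
    rintro ⟨v, t⟩
    rw [InnerProductSpace.toDual_symm_apply]
    have : (v, t) = (v, (0 : ℝ)) + t • ((0 : E), (1 : ℝ)) := by simp
    rw [this, map_add, map_smul]
    simp [mul_comm]
  refine ⟨(InnerProductSpace.toDual ℝ E).symm (L.comp (.inl ℝ E ℝ)), L (0, 1), u, ?_,
    fun w hw => ?_⟩
  · rw [← hL (x, γ)]; exact h1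
  · rw [← hL w]; exact h2 w hw

/-- There is an affine minorant: a hyperplane that separates the epigraph from a point strictly below
a point of the graph is not vertical. -/
lemma ProperLscConvex.exists_mem_epi_conj {ψ : E → EReal} (hψ : ProperLscConvex ψ) :
    ∃ (q : E) (s : ℝ), (q, s) ∈ epi (conj ψ) := by
  obtain ⟨x, hx⟩ := hψ.dom_nonempty
  obtain ⟨a, ha⟩ := hψ.exists_coe hx
  have hmem : (x, a) ∈ epi ψ := ha.le
  obtain ⟨p, τ, u, h1, h2⟩ := hψ.exists_separation (x := x) (γ := a - 1) (by
    simp only [epi, Set.mem_ofPred_eq, ha, not_le]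
    exact EReal.coe_lt_coe_iff.2 (by linarith))
  have hτ : 0 < τ := by
    have := h2 _ hmem
    simp only at this
    nlinarith
  refine ⟨-(τ⁻¹ • p), -(u / τ), mem_epi_conj.2 fun w hw => ?_⟩
  have := h2 w hw
  rw [inner_neg_left, real_inner_smul_left, le_neg, div_le_iff₀ hτ]
  field_simp
  linarith

/-- The Fenchel–Moreau theorem: a proper, lower semicontinuous, convex function lies below its
biconjugate. -/
lemma ProperLscConvex.le_of_forall_conj {ψ : E → EReal} (hψ : ProperLscConvex ψ) {x : E} {γ : ℝ}
    (h : ∀ p ∈ epi (conj ψ), inner ℝ p.1 x - p.2 ≤ γ) : ψ x ≤ γ := by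
  by_contra hx
  obtain ⟨p, τ, u, h1, h2⟩ := hψ.exists_separation (x := x) (γ := γ) hx
  obtain ⟨x₀, hx₀⟩ := hψ.dom_nonempty
  obtain ⟨a, ha⟩ := exists_mem_epi hx₀
  -- The epigraph is unbounded upwards.
  have hτ : 0 ≤ τ := by
    by_contra hneg
    rw [not_le] at hneg
    -- At height `a + t` the functional has dropped to at most `u`.
    set t := (|u - inner ℝ p x₀ - τ * a|) / (-τ) with ht
    have ht0 : 0 ≤ t := div_nonneg (abs_nonneg _) (by linarith)
    have := h2 (x₀, a + t) (le_trans (show ψ x₀ ≤ a from ha)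
      (EReal.coe_le_coe_iff.2 (by linarith)))
    have e : -τ * t = |u - inner ℝ p x₀ - τ * a| := by
      rw [ht, mul_div_cancel₀ _ (by linarith)]
    have := neg_abs_le (u - inner ℝ p x₀ - τ * a)
    simp only at *
    nlinarith
  rcases hτ.eq_or_lt with hτ | hτ
  · -- A vertical hyperplane: tilt an affine minorant along it.
    subst hτ
    obtain ⟨q, s, hq⟩ := hψ.exists_mem_epi_conj
    have hd : 0 < u - inner ℝ p x := by linarith
    -- The tilt `k` is large enough for the tilted minorant to exceed `γ` at `x`.
    set k := (|γ - inner ℝ q x + s| + 1) / (u - inner ℝ p x) with hk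
    have hk0 : 0 ≤ k := by positivity
    have hmem : (q - k • p, s - k * u) ∈ epi (conj ψ) := by
      refine mem_epi_conj.2 fun w hw => ?_
      have e1 := mem_epi_conj.1 hq w hw
      have e2 := mul_le_mul_of_nonneg_left (h2 w hw).le hk0
      simp only [inner_sub_left, real_inner_smul_left]
      linarith
    have e1 := h _ hmem
    simp only [inner_sub_left, real_inner_smul_left] at e1
    have e2 : k * (u - inner ℝ p x) = |γ - inner ℝ q x + s| + 1 := by
      rw [hk]; field_simp
    have := le_abs_self (γ - inner ℝ q x + s)
    linarith
  · have hmem : (-(τ⁻¹ • p), -(u / τ)) ∈ epi (conj ψ) := by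
      refine mem_epi_conj.2 fun w hw => ?_
      have := h2 w hw
      rw [inner_neg_left, real_inner_smul_left, le_neg, div_le_iff₀ hτ]
      field_simp
      linarith
    have := h _ hmem
    simp only [inner_neg_left, real_inner_smul_left] at this
    have e : τ * (-(τ⁻¹ * inner ℝ p x) - -(u / τ)) = u - inner ℝ p x := by
      field_simp; ring
    have := mul_le_mul_of_nonneg_left this hτ.le
    linarith

end Epigraph

/-! ### Subgradients that support the function locally -/

section Subgradient

variable {E : Type*} [NormedAddCommGroup E] [InnerProductSpace ℝ E]

/-- A local affine minorant which is exact at `x` yields a subgradient. -/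
lemma mem_subdiff_of_eventually {ψ : E → EReal} {x q : E} {a : ℝ} (ha : ψ x = a)
    (h : ∀ᶠ x' in 𝓝 x, ((a + inner ℝ q (x' - x) : ℝ) : EReal) ≤ ψ x') : q ∈ subdiff ψ x := by
  have hx : x ∈ dom ψ := by
    simp only [dom, Set.mem_ofPred_eq, ha]; exact EReal.coe_lt_top a
  have hF : q ∈ frechetSubdiff ψ x := by
    refine ⟨hx, le_liminf_of_le (by isBoundedDefault) ?_⟩
    filter_upwards [h.filter_mono nhdsWithin_le_nhds] with x' hx'
    refine EReal.div_nonneg ?_ (EReal.coe_nonneg.2 (norm_nonneg _))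
    rw [ha]
    induction hv : ψ x' with
    | bot => rw [hv] at hx'; exact absurd hx' (by simp)
    | top => simp
    | coe c =>
      rw [hv] at hx'
      norm_cast at hx' ⊢
      linarith
  exact ⟨hx, fun _ => x, fun _ => q, tendsto_const_nhds, tendsto_const_nhds, fun _ => hF,
    tendsto_const_nhds⟩

end Subgradient

/-! ### Cardinality functions near a point -/

section Cardinality

variable {r : ℕ}

lemma vec_inner (z u : Vec r) : inner ℝ z u = ∑ i, z i * u i := by
  simp [PiLp.inner_apply, mul_comm]

lemma eventually_apply {p : Fin r → ℝ → Prop} {u : Vec r} (h : ∀ i, ∀ᶠ s in 𝓝 (u i), p i s) :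
    ∀ᶠ u' in 𝓝 u, ∀ i, p i (u' i) :=
  eventually_all.2 fun i =>
    (show Continuous fun u' : Vec r => u' i by fun_prop).continuousAt.eventually (h i)

lemma eventually_mul_lt (z : ℝ) {c : ℝ} (hc : 0 < c) : ∀ᶠ s in 𝓝 (0 : ℝ), z * s < c := by
  have : Continuous fun s : ℝ => z * s := by fun_prop
  exact this.continuousAt.eventually_lt continuousAt_const (by simpa using hc)

/-- Complementary vectors are subgradients of the weighted count of nonzero entries: near `u` each
linear perturbation is dominated by the jump of the count. -/
lemma card0_eventually {c : Fin r → ℝ} (hc : ∀ i, 0 < c i) {u z : Vec r}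
    (h : ∀ i, u i ≠ 0 → z i = 0) :
    ∀ᶠ u' in 𝓝 u, card0 c u + ((inner ℝ z u' : ℝ) : EReal) ≤ card0 c u' := by
  have key : ∀ i, ∀ᶠ s in 𝓝 (u i),
      (if u i ≠ 0 then c i else 0) + z i * s ≤ if s ≠ 0 then c i else 0 := by
    intro i
    by_cases hi : u i = 0
    · rw [hi]
      filter_upwards [eventually_mul_lt (z i) (hc i)] with s hs
      by_cases hs0 : s = 0
      · simp [hs0]
      · simp [hs0, hs.le]
    · filter_upwards [eventually_ne_nhds hi] with s hs
      simp [hi, hs, h i hi]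
  filter_upwards [eventually_apply key] with u' hu'
  simp only [card0, vec_inner]
  rw [← EReal.coe_add, EReal.coe_le_coe_iff, ← Finset.sum_add_distrib]
  exact Finset.sum_le_sum fun i _ => hu' i

/-- Nonnegative complementary vectors are subgradients of the weighted count of positive entries. -/
lemma cardPos_eventually {c : Fin r → ℝ} (hc : ∀ i, 0 < c i) {u z : Vec r}
    (h : ∀ i, u i ≠ 0 → z i = 0) (hz : ∀ i, 0 ≤ z i) :
    ∀ᶠ u' in 𝓝 u, cardPos c u + ((inner ℝ z u' : ℝ) : EReal) ≤ cardPos c u' := by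
  have key : ∀ i, ∀ᶠ s in 𝓝 (u i),
      (if 0 < u i then c i else 0) + z i * s ≤ if 0 < s then c i else 0 := by
    intro i
    by_cases hi : u i = 0
    · rw [hi]
      filter_upwards [eventually_mul_lt (z i) (hc i)] with s hs
      by_cases hs0 : 0 < s
      · simp [hs0, hs.le]
      · simpa [hs0] using mul_nonpos_of_nonneg_of_nonpos (hz i) (not_lt.1 hs0)
    · by_cases hp : 0 < u i
      · filter_upwards [eventually_gt_nhds hp] with s hs
        simp [hp, hs, h i hi]
      · refine Eventually.of_forall fun s => ?_
        simp only [hp, h i hi, if_false, zero_mul, add_zero]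
        split_ifs
        exacts [(hc i).le, le_rfl]
  filter_upwards [eventually_apply key] with u' hu'
  simp only [cardPos, vec_inner]
  rw [← EReal.coe_add, EReal.coe_le_coe_iff, ← Finset.sum_add_distrib]
  exact Finset.sum_le_sum fun i _ => hu' i

lemma card0_le_of_support {c : Fin r → ℝ} (hc : ∀ i, 0 < c i) {u u' : Vec r}
    (h : ∀ i, u i = 0 → u' i = 0) : card0 c u' ≤ card0 c u := by
  simp only [card0]
  rw [EReal.coe_le_coe_iff]
  refine Finset.sum_le_sum fun i _ => ?_
  by_cases hi : u i = 0
  · simp [hi, h i hi]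
  · rw [if_pos hi]
    split_ifs
    exacts [le_refl (c i), (hc i).le]

/-- Near `u`, the count of positive entries can only increase through the entries where `u`
vanishes. -/
lemma cardPos_eventually_le {c : Fin r → ℝ} (u : Vec r) :
    ∀ᶠ u' in 𝓝 u, (∀ i, u i = 0 → u' i ≤ 0) → cardPos c u' ≤ cardPos c u := by
  have key : ∀ i, ∀ᶠ s in 𝓝 (u i), (u i = 0 → s ≤ 0) →
      (if 0 < s then c i else 0) ≤ if 0 < u i then c i else 0 := by
    intro i
    rcases lt_trichotomy (u i) 0 with hi | hi | hi
    · filter_upwards [eventually_lt_nhds hi] with s hs _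
      simp [hs.not_gt, hi.not_gt]
    · refine Eventually.of_forall fun s hs => ?_
      simp [(hs hi).not_gt, hi]
    · filter_upwards [eventually_gt_nhds hi] with s hs _
      simp [hs, hi]
  filter_upwards [eventually_apply key] with u' hu' h
  simp only [cardPos]
  rw [EReal.coe_le_coe_iff]
  exact Finset.sum_le_sum fun i _ => hu' i (h i)

lemma PsiPlus_of_nonneg {c : Fin r → ℝ} {z : Vec r} (hz : ∀ i, 0 ≤ z i) :
    PsiPlus c z = card0 c z := by
  have : z ∈ {v : Vec r | ∀ i, 0 ≤ v i} := hz
  simp [PsiPlus, indic, this]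

lemma nonneg_of_PsiPlus_lt_top {c : Fin r → ℝ} {z : Vec r} (hz : PsiPlus c z < ⊤) (i : Fin r) :
    0 ≤ z i := by
  by_contra h
  have : z ∉ {v : Vec r | ∀ i, 0 ≤ v i} := fun h' => h (h' i)
  simp [PsiPlus, indic, this, card0] at hz

lemma card0_le_PsiPlus (c : Fin r → ℝ) (z : Vec r) : card0 c z ≤ PsiPlus c z := by
  unfold PsiPlus indic
  split_ifs <;> simp [card0]

end Cardinality


/-! ### Strong duality for the convex parts -/

section Duality

variable {n m r : ℕ}

lemma mv_eq_toEuclideanLin (A : Matrix (Fin m) (Fin n) ℝ) (x : Vec n) :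
    mv A x = Matrix.toEuclideanLin A x := rfl

lemma inner_mv_transpose (A : Matrix (Fin m) (Fin n) ℝ) (y : Vec m) (x : Vec n) :
    inner ℝ (mv A.transpose y) x = inner ℝ y (mv A x) := by
  have := Matrix.toEuclideanLin_conjTranspose_eq_adjoint A
  rw [Matrix.conjTranspose_eq_transpose_of_trivial] at this
  rw [mv_eq_toEuclideanLin, mv_eq_toEuclideanLin, this, LinearMap.adjoint_inner_left]

lemma inner_QT (A : Matrix (Fin m) (Fin n) ℝ) (B : Matrix (Fin r) (Fin n) ℝ)
    (w : Vec m × Vec r) (x : Vec n) :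
    inner ℝ (QT A B w) x = inner ℝ w.1 (mv A x) + inner ℝ w.2 (mv B x) := by
  rw [QT, inner_add_left, inner_mv_transpose, inner_mv_transpose]

lemma continuous_mv (A : Matrix (Fin m) (Fin n) ℝ) : Continuous (mv A) :=
  (Matrix.toEuclideanLin A).continuous_of_finiteDimensional

/-- Linear forms on a Euclidean space are inner products. -/
lemma exists_inner_eq (κ : Vec n →ₗ[ℝ] ℝ) : ∃ q : Vec n, ∀ x, κ x = inner ℝ q x :=
  ⟨(InnerProductSpace.toDual ℝ (Vec n)).symm (LinearMap.toContinuousLinearMap κ), fun x => by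
    rw [InnerProductSpace.toDual_symm_apply]; rfl⟩

variable {f : Vec n → EReal} {g : Vec m → EReal} {A : Matrix (Fin m) (Fin n) ℝ}
  {B : Matrix (Fin r) (Fin n) ℝ} {b : Vec r}

/-- Lagrange multipliers for the primal problem, in which `Φ` is replaced near `B x - b` by the
constraint `B x - b ∈ U`. The optimization runs over the product of the two epigraphs with `U`. -/
lemma primal_multipliers {Φ : Vec r → EReal} (hf : Convex ℝ (epi f)) (hg : Convex ℝ (epi g))
    {xs : Vec n} (hmin : IsLocalMin (primalObj f g A B b Φ) xs) {a c p : ℝ} (ha : f xs = a)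
    (hc : g (mv A xs) = c) (hp : Φ (mv B xs - b) = p) {U : Set (Vec r)}
    (hxU : mv B xs - b ∈ U) (hU : ∀ᶠ u in 𝓝 (mv B xs - b), u ∈ U → Φ u ≤ Φ (mv B xs - b))
    (hslater : ∃ x, x ∈ slaterDom f ∧ mv A x ∈ slaterDom g ∧ SlaterSet U (mv B x - b)) :
    ∃ (y : Vec m) (z : Vec r), ∀ p₁ ∈ epi f, ∀ p₂ ∈ epi g, ∀ u ∈ U,
      a + c ≤ p₁.2 + p₂.2 + inner ℝ y (mv A p₁.1 - p₂.1) + inner ℝ z (mv B p₁.1 - b - u) := by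
  obtain ⟨x, hxf, hxg, hxU'⟩ := hslater
  obtain ⟨t₁, h₁⟩ := exists_slaterSet_epi hf hxf
  obtain ⟨t₂, h₂⟩ := exists_slaterSet_epi hg hxg
  have hS := (h₁.prod h₂).prod hxU'
  -- In the variable `((x, t₁), (y, t₂), u)`, the map `M` vanishes exactly when `y = A x` and
  -- `u = B x - b`; the objective is `ℓ = t₁ + t₂`.
  let M : ((Vec n × ℝ) × (Vec m × ℝ)) × Vec r →ᵃ[ℝ] Vec m × Vec r :=
    (LinearMap.prod
      ((Matrix.toEuclideanLin A).comp (LinearMap.fst ℝ _ _ ∘ₗ LinearMap.fst ℝ _ _ ∘ₗ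
        LinearMap.fst ℝ _ _) - LinearMap.fst ℝ _ _ ∘ₗ LinearMap.snd ℝ _ _ ∘ₗ LinearMap.fst ℝ _ _)
      ((Matrix.toEuclideanLin B).comp (LinearMap.fst ℝ _ _ ∘ₗ LinearMap.fst ℝ _ _ ∘ₗ
        LinearMap.fst ℝ _ _) - LinearMap.snd ℝ _ _)).toAffineMap - AffineMap.const ℝ _ (0, b)
  have hM : ∀ v, M v = (mv A v.1.1.1 - v.1.2.1, mv B v.1.1.1 - v.2 - b) := by
    intro v; ext1 <;> simp [M, mv_eq_toEuclideanLin]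
  let ℓ : ((Vec n × ℝ) × (Vec m × ℝ)) × Vec r →ᵃ[ℝ] ℝ :=
    (LinearMap.snd ℝ _ _ ∘ₗ LinearMap.fst ℝ _ _ ∘ₗ LinearMap.fst ℝ _ _ +
      LinearMap.snd ℝ _ _ ∘ₗ LinearMap.snd ℝ _ _ ∘ₗ LinearMap.fst ℝ _ _).toAffineMap
  have hℓ : ∀ v, ℓ v = v.1.1.2 + v.1.2.2 := fun v => rfl
  obtain ⟨κ, hκ⟩ := hS.exists_lagrangian M (by simp [hM]) ℓ
    (v₀ := (((xs, a), (mv A xs, c)), mv B xs - b)) ⟨⟨ha.le, hc.le⟩, hxU⟩ (by simp [hM]) (by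
      have hx : Tendsto (fun v : ((Vec n × ℝ) × (Vec m × ℝ)) × Vec r => v.1.1.1)
          (𝓝 (((xs, a), (mv A xs, c)), mv B xs - b)) (𝓝 xs) :=
        (show Continuous fun v : ((Vec n × ℝ) × (Vec m × ℝ)) × Vec r => v.1.1.1 by
          fun_prop).continuousAt
      have hu : Tendsto (fun v : ((Vec n × ℝ) × (Vec m × ℝ)) × Vec r => v.2)
          (𝓝 (((xs, a), (mv A xs, c)), mv B xs - b)) (𝓝 (mv B xs - b)) :=
        continuous_snd.continuousAt
      filter_upwards [hx.eventually hmin, hu.eventually hU]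
      rintro ⟨⟨⟨x', s₁⟩, ⟨y', s₂⟩⟩, u⟩ h1 h2 ⟨⟨h3, h4⟩, h5⟩ h6
      rw [hM, Prod.mk_eq_zero] at h6
      obtain rfl : mv A x' = y' := sub_eq_zero.1 h6.1
      obtain rfl : mv B x' - b = u := by rw [← sub_eq_zero, ← h6.2]; abel
      have h7 := h2 h5
      rw [hp] at h7
      simp only [primalObj, Theta, ha, hc, hp] at h1
      have h8 : ((a + c + p : ℝ) : EReal) ≤ ((s₁ + s₂ + p : ℝ) : EReal) := by
        push_cast
        exact h1.trans (add_le_add (add_le_add h3 h4) h7)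
      rw [EReal.coe_le_coe_iff] at h8
      simp only [hℓ]
      linarith)
  obtain ⟨y, hy⟩ := exists_inner_eq (κ ∘ₗ LinearMap.inl ℝ _ _)
  obtain ⟨z, hz⟩ := exists_inner_eq (κ ∘ₗ LinearMap.inr ℝ _ _)
  refine ⟨y, z, fun p₁ h1 p₂ h2 u h3 => ?_⟩
  have h := hκ ((p₁, p₂), u) ⟨⟨h1, h2⟩, h3⟩
  rw [hM] at h
  have hsum : ∀ v w, κ (v, w) = inner ℝ y v + inner ℝ z w := by
    intro v w
    rw [← hy, ← hz]
    simp [← map_add]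
  rw [hsum, hℓ, hℓ] at h
  rw [sub_right_comm (mv B p₁.1) b u]
  simp only at h
  linarith

/-- Lagrange multipliers for the dual problem, in which `Ψ` is replaced near `z` by the constraint
`z ∈ V`. The multiplier of the equation `p = -Qᵀ w` is a primal point. -/
lemma dual_multipliers {Ψ : Vec r → EReal} {ws : Vec m × Vec r}
    (hmin : IsLocalMin (dualObj f g A B b Ψ) ws) {a c p : ℝ} (ha : conj f (-QT A B ws) = a)
    (hc : conj g ws.1 = c) (hp : Ψ ws.2 = p) {V : Set (Vec r)}
    (hzV : ws.2 ∈ V) (hV : ∀ᶠ z in 𝓝 ws.2, z ∈ V → Ψ z ≤ Ψ ws.2)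
    (hslater : ∃ w : Vec m × Vec r, -QT A B w ∈ slaterDom (conj f) ∧ w.1 ∈ slaterDom (conj g) ∧
      SlaterSet V w.2) :
    ∃ x : Vec n, ∀ p₁ ∈ epi (conj f), ∀ p₂ ∈ epi (conj g), ∀ z ∈ V,
      a + c + inner ℝ b ws.2 ≤
        p₁.2 + p₂.2 + inner ℝ b z - inner ℝ x (p₁.1 + QT A B (p₂.1, z)) := by
  obtain ⟨⟨y, z⟩, hwf, hwg, hwV⟩ := hslater
  obtain ⟨t₁, h₁⟩ := exists_slaterSet_epi (convex_epi_conj f) hwf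
  obtain ⟨t₂, h₂⟩ := exists_slaterSet_epi (convex_epi_conj g) hwg
  have hS := (h₁.prod h₂).prod hwV
  -- In the variable `((q, t₁), (y, t₂), z)`, the map `M` vanishes exactly when `q = -Qᵀ (y, z)`;
  -- the objective is `ℓ = t₁ + t₂ + ⟨b, z⟩`.
  let M : ((Vec n × ℝ) × (Vec m × ℝ)) × Vec r →ᵃ[ℝ] Vec n :=
    (LinearMap.fst ℝ _ _ ∘ₗ LinearMap.fst ℝ _ _ ∘ₗ LinearMap.fst ℝ _ _ +
      ((Matrix.toEuclideanLin A.transpose).comp (LinearMap.fst ℝ _ _ ∘ₗ LinearMap.snd ℝ _ _ ∘ₗ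
        LinearMap.fst ℝ _ _) +
      (Matrix.toEuclideanLin B.transpose).comp (LinearMap.snd ℝ _ _))).toAffineMap
  have hM : ∀ v, M v = v.1.1.1 + QT A B (v.1.2.1, v.2) := fun v => rfl
  let ℓ : ((Vec n × ℝ) × (Vec m × ℝ)) × Vec r →ᵃ[ℝ] ℝ :=
    (LinearMap.snd ℝ _ _ ∘ₗ LinearMap.fst ℝ _ _ ∘ₗ LinearMap.fst ℝ _ _ +
      LinearMap.snd ℝ _ _ ∘ₗ LinearMap.snd ℝ _ _ ∘ₗ LinearMap.fst ℝ _ _ +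
      (innerₛₗ ℝ b) ∘ₗ LinearMap.snd ℝ _ _).toAffineMap
  have hℓ : ∀ v, ℓ v = v.1.1.2 + v.1.2.2 + inner ℝ b v.2 := fun v => rfl
  obtain ⟨κ, hκ⟩ := hS.exists_lagrangian M (by simp [hM]) ℓ
    (v₀ := (((-QT A B ws, a), (ws.1, c)), ws.2)) ⟨⟨ha.le, hc.le⟩, hzV⟩ (by simp [hM]) (by
      have hw : Tendsto (fun v : ((Vec n × ℝ) × (Vec m × ℝ)) × Vec r => (v.1.2.1, v.2))
          (𝓝 (((-QT A B ws, a), (ws.1, c)), ws.2)) (𝓝 ws) :=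
        (show Continuous fun v : ((Vec n × ℝ) × (Vec m × ℝ)) × Vec r => (v.1.2.1, v.2) by
          fun_prop).continuousAt
      have hz : Tendsto (fun v : ((Vec n × ℝ) × (Vec m × ℝ)) × Vec r => v.2)
          (𝓝 (((-QT A B ws, a), (ws.1, c)), ws.2)) (𝓝 ws.2) :=
        continuous_snd.continuousAt
      filter_upwards [hw.eventually hmin, hz.eventually hV]
      rintro ⟨⟨⟨q, s₁⟩, ⟨y', s₂⟩⟩, z'⟩ h1 h2 ⟨⟨h3, h4⟩, h5⟩ h6
      rw [hM] at h6
      obtain rfl : q = -QT A B (y', z') := eq_neg_of_add_eq_zero_left h6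
      have h7 := h2 h5
      rw [hp] at h7
      simp only [dualObj, Xi, ha, hc, hp] at h1
      have h8 : ((a + c + inner ℝ b ws.2 + p : ℝ) : EReal) ≤
          ((s₁ + s₂ + inner ℝ b z' + p : ℝ) : EReal) := by
        push_cast
        exact h1.trans (add_le_add (add_le_add (add_le_add h3 h4) le_rfl) h7)
      rw [EReal.coe_le_coe_iff] at h8
      simp only [hℓ]
      linarith)
  obtain ⟨x, hx⟩ := exists_inner_eq κ
  refine ⟨-x, fun p₁ h1 p₂ h2 z h3 => ?_⟩
  have h := hκ ((p₁, p₂), z) ⟨⟨h1, h2⟩, h3⟩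
  rw [hM, hx, hℓ, hℓ] at h
  rw [inner_neg_left]
  simp only at h
  linarith

/-- Weak duality, with the pairing of `B x - b` and `z` as the gap. -/
lemma le_Xi {x : Vec n} {a c : ℝ} (ha : f x = a) (hc : g (mv A x) = c) (w : Vec m × Vec r) :
    ((-(a + c) - inner ℝ (mv B x - b) w.2 : ℝ) : EReal) ≤ Xi f g A B b w := by
  have h1 := inner_sub_le_conj f ha (-QT A B w)
  have h2 := inner_sub_le_conj g hc w.1
  refine le_trans (le_of_eq ?_) (add_le_add (add_le_add h1 h2) le_rfl)
  rw [← EReal.coe_add, ← EReal.coe_add, inner_neg_left, inner_QT, inner_sub_left,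
    real_inner_comm w.2 (mv B x)]
  congr 1
  ring

/-- Weak duality, read as a lower bound of the primal function. -/
lemma le_Theta {w : Vec m × Vec r} {a c : ℝ} (ha : conj f (-QT A B w) = a) (hc : conj g w.1 = c)
    (x : Vec n) :
    ((-(a + c + inner ℝ b w.2) - inner ℝ w.2 (mv B x - b) : ℝ) : EReal) ≤ Theta f g A x := by
  have key : ∀ {k : ℕ} {ψ : Vec k → EReal} {q : Vec k} {s : ℝ}, conj ψ q = s → ∀ v,
      ((inner ℝ q v - s : ℝ) : EReal) ≤ ψ v := by
    intro k ψ q s hs v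
    induction hv : ψ v with
    | bot =>
      have := conj_le_coe_iff.1 hs.le (v, inner ℝ q v - s - 1) (by simp [epi, hv])
      simp only at this
      linarith
    | top => exact le_top
    | coe t =>
      have := conj_le_coe_iff.1 hs.le (v, t) (by simp [epi, hv])
      rw [EReal.coe_le_coe_iff]
      simp only at this
      linarith
  refine le_trans (le_of_eq ?_) (add_le_add (key ha x) (key hc (mv A x)))
  rw [← EReal.coe_add, inner_neg_left, inner_QT, inner_sub_right, real_inner_comm b w.2]
  congr 1
  ring

/-- From a primal local minimizer to a dual one. The vectors normal to `U` are required to be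
orthogonal to `B x - b`, and the two vectors are required to support `Φ` and `Ψ` locally. -/
theorem primal_to_dual {Φ Ψ : Vec r → EReal} (hf : ProperLscConvex f) (hg : ProperLscConvex g)
    {xs : Vec n} (hmin : IsLocalMinimizer (primalObj f g A B b Φ) xs) {p : ℝ}
    (hp : Φ (mv B xs - b) = p) {U : Set (Vec r)}
    (hxU : mv B xs - b ∈ U) (hU : ∀ᶠ u in 𝓝 (mv B xs - b), u ∈ U → Φ u ≤ Φ (mv B xs - b))
    (hslater : ∃ x, x ∈ slaterDom f ∧ mv A x ∈ slaterDom g ∧ SlaterSet U (mv B x - b))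
    (hN : ∀ z : Vec r, (∀ u ∈ U, inner ℝ z u ≤ inner ℝ z (mv B xs - b)) →
      inner ℝ z (mv B xs - b) = 0 ∧
      (∀ᶠ u in 𝓝 (mv B xs - b), Φ (mv B xs - b) + ((inner ℝ z u : ℝ) : EReal) ≤ Φ u) ∧
      (∃ s : ℝ, Ψ z = s) ∧
      ∀ᶠ z' in 𝓝 z, Ψ z + ((inner ℝ (mv B xs - b) z' : ℝ) : EReal) ≤ Ψ z') :
    ∃ (ys : Vec m) (zs : Vec r), ys ∈ subdiff g (mv A xs) ∧ zs ∈ subdiff Φ (mv B xs - b) ∧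
      IsLocalMinimizer (dualObj f g A B b Ψ) (ys, zs) ∧
      Theta f g A xs = -Xi f g A B b (ys, zs) := by
  have hfin : f xs < ⊤ ∧ g (mv A xs) < ⊤ := by
    have h := hmin.1
    simp only [primalObj, Theta, hp] at h
    constructor
    · rw [lt_top_iff_ne_top]; intro h'
      rw [h', EReal.top_add_of_ne_bot (hg.ne_bot _)] at h
      simp at h
    · rw [lt_top_iff_ne_top]; intro h'
      rw [h', EReal.add_top_of_ne_bot (hf.ne_bot _)] at h
      simp at h
  obtain ⟨a, ha⟩ := hf.exists_coe hfin.1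
  obtain ⟨c, hc⟩ := hg.exists_coe hfin.2
  obtain ⟨y, z, hyz⟩ := primal_multipliers hf.convex hg.convex hmin.2 ha hc hp hxU hU hslater
  have hfa : (xs, a) ∈ epi f := ha.le
  have hgc : (mv A xs, c) ∈ epi g := hc.le
  obtain ⟨h0, hΦ, ⟨s, hs⟩, hΨ⟩ := hN z (fun u hu => by
    have := hyz _ hfa _ hgc u hu
    simp only [sub_self, inner_zero_right, inner_sub_right] at this ⊢
    linarith)
  have hcg : conj g y = ((inner ℝ y (mv A xs) - c : ℝ) : EReal) := by
    refine le_antisymm (conj_le_coe_iff.2 fun p₂ h₂ => ?_) (inner_sub_le_conj g hc y)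
    have := hyz _ hfa p₂ h₂ _ hxU
    simp only [sub_self, inner_zero_right, inner_sub_right] at this
    linarith
  have hcf : conj f (-QT A B (y, z)) =
      ((inner ℝ (-QT A B (y, z)) xs - a : ℝ) : EReal) := by
    refine le_antisymm (conj_le_coe_iff.2 fun p₁ h₁ => ?_) (inner_sub_le_conj f ha _)
    have := hyz p₁ h₁ _ hgc _ hxU
    simp only [inner_neg_left, inner_QT, inner_sub_right] at this ⊢
    linarith
  have hXi : Xi f g A B b (y, z) = ((-(a + c) : ℝ) : EReal) := by
    rw [Xi, hcf, hcg, ← EReal.coe_add, ← EReal.coe_add, inner_neg_left, inner_QT]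
    rw [inner_sub_right, real_inner_comm b z] at h0
    congr 1
    simp only
    linarith
  refine ⟨y, z, ?_, ?_, ⟨?_, ?_⟩, ?_⟩
  · refine mem_subdiff_of_eventually hc (Eventually.of_forall fun v => ?_)
    induction hv : g v with
    | bot => exact absurd hv (hg.ne_bot v)
    | top => exact le_top
    | coe t =>
      have := conj_le_coe_iff.1 hcg.le (v, t) hv.le
      rw [EReal.coe_le_coe_iff, inner_sub_right]
      simp only at this
      linarith
  · refine mem_subdiff_of_eventually hp ?_
    filter_upwards [hΦ] with u hu
    rw [hp] at hu
    rw [inner_sub_right, h0, sub_zero, EReal.coe_add]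
    exact hu
  · simp only [dualObj, hXi, hs]
    rw [← EReal.coe_add]
    exact EReal.coe_lt_top _
  · have hsnd : Tendsto (fun w : Vec m × Vec r => w.2) (𝓝 (y, z)) (𝓝 z) :=
      continuous_snd.continuousAt
    filter_upwards [hsnd.eventually hΨ] with w hw
    rw [hs] at hw
    simp only [dualObj, hXi, hs]
    refine le_trans (le_of_eq ?_) (add_le_add (le_Xi ha hc w) hw)
    rw [← EReal.coe_add, ← EReal.coe_add, ← EReal.coe_add]
    congr 1
    ring
  · rw [hXi, Theta, ha, hc, ← EReal.coe_neg, neg_neg, EReal.coe_add]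

/-- From a dual local minimizer to a primal one. The Fenchel–Moreau theorem turns the multiplier
`x`, which is a subgradient of the conjugate of `f`, into a point where `f` and `g` are finite and
the Fenchel–Young inequalities are equalities. -/
theorem dual_to_primal {Φ Ψ : Vec r → EReal} (hf : ProperLscConvex f) (hg : ProperLscConvex g)
    {ws : Vec m × Vec r} (hmin : IsLocalMinimizer (dualObj f g A B b Ψ) ws) {p : ℝ}
    (hp : Ψ ws.2 = p) {V : Set (Vec r)}
    (hzV : ws.2 ∈ V) (hV : ∀ᶠ z in 𝓝 ws.2, z ∈ V → Ψ z ≤ Ψ ws.2)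
    (hslater : ∃ w : Vec m × Vec r, -QT A B w ∈ slaterDom (conj f) ∧ w.1 ∈ slaterDom (conj g) ∧
      SlaterSet V w.2)
    (hN : ∀ u : Vec r, (∀ z ∈ V, inner ℝ u z ≤ inner ℝ u ws.2) →
      inner ℝ u ws.2 = 0 ∧ (∃ s : ℝ, Φ u = s) ∧
      ∀ᶠ u' in 𝓝 u, Φ u + ((inner ℝ ws.2 u' : ℝ) : EReal) ≤ Φ u') :
    ∃ xs : Vec n, xs ∈ subdiff (conj f) (-QT A B ws) ∧
      IsLocalMinimizer (primalObj f g A B b Φ) xs ∧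
      Theta f g A xs = -Xi f g A B b ws := by
  have hfin : conj f (-QT A B ws) < ⊤ ∧ conj g ws.1 < ⊤ := by
    have h := hmin.1
    simp only [dualObj, Xi, hp] at h
    constructor
    · rw [lt_top_iff_ne_top]; intro h'
      rw [h', EReal.top_add_of_ne_bot (conj_ne_bot hg _)] at h
      simp at h
    · rw [lt_top_iff_ne_top]; intro h'
      rw [h', EReal.add_top_of_ne_bot (conj_ne_bot hf _)] at h
      simp at h
  obtain ⟨a, ha⟩ : ∃ a : ℝ, conj f (-QT A B ws) = a :=
    ⟨_, (EReal.coe_toReal hfin.1.ne (conj_ne_bot hf _)).symm⟩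
  obtain ⟨c, hc⟩ : ∃ c : ℝ, conj g ws.1 = c :=
    ⟨_, (EReal.coe_toReal hfin.2.ne (conj_ne_bot hg _)).symm⟩
  obtain ⟨x, hx⟩ := dual_multipliers hmin.2 ha hc hp hzV hV hslater
  have hfa : (-QT A B ws, a) ∈ epi (conj f) := ha.le
  have hgc : (ws.1, c) ∈ epi (conj g) := hc.le
  have hQ : ∀ w, inner ℝ x (QT A B w) = inner ℝ w.1 (mv A x) + inner ℝ w.2 (mv B x) := by
    intro w; rw [real_inner_comm, inner_QT]
  obtain ⟨h0, ⟨s, hs⟩, hΦ⟩ := hN (mv B x - b) (fun z hz => by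
    have := hx _ hfa _ hgc z hz
    simp only [inner_add_right, inner_neg_right, hQ] at this
    simp only [inner_sub_left, real_inner_comm _ (mv B x)] at this ⊢
    linarith)
  have h0' : inner ℝ ws.2 (mv B x) - inner ℝ b ws.2 = 0 := by
    rwa [inner_sub_left, real_inner_comm] at h0
  have hfx : f x ≤ ((inner ℝ (-QT A B ws) x - a : ℝ) : EReal) := by
    refine hf.le_of_forall_conj fun p₁ h₁ => ?_
    have := hx p₁ h₁ _ hgc _ hzV
    simp only [inner_add_right, inner_neg_left, inner_QT, hQ, real_inner_comm p₁.1 x] at this ⊢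
    linarith
  have hgx : g (mv A x) ≤ ((inner ℝ ws.1 (mv A x) - c : ℝ) : EReal) := by
    refine hg.le_of_forall_conj fun p₂ h₂ => ?_
    have := hx _ hfa p₂ h₂ _ hzV
    simp only [inner_add_right, inner_neg_right, hQ] at this
    linarith
  have hTh : Theta f g A x = ((-(a + c + inner ℝ b ws.2) : ℝ) : EReal) := by
    refine le_antisymm ((add_le_add hfx hgx).trans (le_of_eq ?_))
      (le_trans (le_of_eq ?_) (le_Theta (b := b) ha hc x))
    · rw [← EReal.coe_add, inner_neg_left, inner_QT]
      congr 1
      linarith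
    · rw [inner_sub_right, real_inner_comm b ws.2]
      congr 1
      linarith
  refine ⟨x, ?_, ⟨?_, ?_⟩, ?_⟩
  · obtain ⟨t, ht⟩ := hf.exists_coe (hfx.trans_lt (EReal.coe_lt_top _))
    rw [ht, EReal.coe_le_coe_iff] at hfx
    refine mem_subdiff_of_eventually ha (Eventually.of_forall fun q => ?_)
    refine le_trans (EReal.coe_le_coe_iff.2 ?_) (inner_sub_le_conj f ht q)
    rw [inner_sub_right, real_inner_comm x q, real_inner_comm (-QT A B ws) x]
    linarith
  · simp only [primalObj, hTh, hs]
    rw [← EReal.coe_add]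
    exact EReal.coe_lt_top _
  · have hcont : Tendsto (fun x' => mv B x' - b) (𝓝 x) (𝓝 (mv B x - b)) :=
      ((continuous_mv B).sub continuous_const).continuousAt
    filter_upwards [hcont.eventually hΦ] with x' hx'
    rw [hs] at hx'
    simp only [primalObj, hTh, hs]
    refine le_trans (le_of_eq ?_) (add_le_add (le_Theta (b := b) ha hc x') hx')
    rw [← EReal.coe_add, ← EReal.coe_add, ← EReal.coe_add]
    congr 1
    ring
  · rw [hTh, Xi, ha, hc, ← EReal.coe_add, ← EReal.coe_add, ← EReal.coe_neg]

end Duality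


/-! ### Sign constraints and their normal vectors -/

section Signs

variable {r : ℕ}

/-- The vectors with nonpositive entries at the indices in `p` and nonnegative entries at the
indices in `q`; an index in both carries the constraint that the entry vanishes. -/
def signCone (p q : Fin r → Prop) : Set (Vec r) :=
  {v | (∀ i, p i → v i ≤ 0) ∧ ∀ i, q i → 0 ≤ v i}

lemma slaterSet_signCone {p q : Fin r → Prop} {u : Vec r} (hu : u ∈ signCone p q) :
    SlaterSet (signCone p q) u := by
  let a : {i // p i} ⊕ {i // q i} → Vec r →ᵃ[ℝ] ℝ :=
    Sum.elim (fun i => (EuclideanSpace.proj i.1 : Vec r →L[ℝ] ℝ).toLinearMap.toAffineMap)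
      (fun i => (-(EuclideanSpace.proj i.1 : Vec r →L[ℝ] ℝ).toLinearMap).toAffineMap)
  have h : signCone p q = {v | ∀ i, a i v ≤ 0} := by
    ext v
    simp [signCone, a]
  rw [h] at hu ⊢
  exact slaterSet_of_finite a hu

/-- A normal vector of `S` at `u` is tested with the coordinate directions. -/
lemma mul_nonpos_of_normal {S : Set (Vec r)} {z u : Vec r}
    (h : ∀ v ∈ S, inner ℝ z v ≤ inner ℝ z u) (i : Fin r) (t : ℝ)
    (hm : u + EuclideanSpace.single i t ∈ S) : z i * t ≤ 0 := by
  have := h _ hm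
  rw [inner_add_right, EuclideanSpace.inner_single_right] at this
  simp only [conj_trivial] at this
  linarith

lemma add_single_mem_signCone {p q : Fin r → Prop} {u : Vec r} (hu : u ∈ signCone p q)
    {i : Fin r} {t : ℝ} (hp : p i → u i + t ≤ 0) (hq : q i → 0 ≤ u i + t) :
    u + EuclideanSpace.single i t ∈ signCone p q := by
  refine ⟨fun j hj => ?_, fun j hj => ?_⟩ <;> by_cases h : j = i
  · subst h; simpa using hp hj
  · simpa [h] using hu.1 j hj
  · subst h; simpa using hq hj
  · simpa [h] using hu.2 j hj

/-- A normal vector at `u` vanishes at the indices outside `p` where `u` does not: a nonnegativity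
constraint there is inactive. -/
lemma eq_zero_of_normal {p q : Fin r → Prop} {z u : Vec r} (hu : u ∈ signCone p q)
    (h : ∀ v ∈ signCone p q, inner ℝ z v ≤ inner ℝ z u) {i : Fin r} (hi : u i ≠ 0)
    (hp : ¬ p i) : z i = 0 := by
  -- Doubling the entry or replacing it by `0` respects a constraint on its sign.
  have h1 := mul_nonpos_of_normal h i (u i)
    (add_single_mem_signCone hu (fun h => absurd h hp) fun hq => by linarith [hu.2 i hq])
  have h2 := mul_nonpos_of_normal h i (-u i)
    (add_single_mem_signCone hu (fun h => absurd h hp) fun _ => by linarith)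
  have h3 : z i * u i = 0 := by linarith
  exact (mul_eq_zero.1 h3).resolve_right hi

lemma nonneg_of_normal {p q : Fin r → Prop} {z u : Vec r} (hu : u ∈ signCone p q)
    (h : ∀ v ∈ signCone p q, inner ℝ z v ≤ inner ℝ z u) {i : Fin r} (hq : ¬ q i) : 0 ≤ z i := by
  have := mul_nonpos_of_normal h i (-1)
    (add_single_mem_signCone hu (fun hp => by linarith [hu.1 i hp]) fun h => absurd h hq)
  linarith

lemma inner_eq_zero_of_complementary {z u : Vec r} (h : ∀ i, u i ≠ 0 → z i = 0) :
    inner ℝ z u = 0 := by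
  rw [vec_inner]
  refine Finset.sum_eq_zero fun i _ => ?_
  by_cases hi : u i = 0
  · rw [hi, mul_zero]
  · rw [h i hi, zero_mul]

lemma complementary_symm {z u : Vec r} (h : ∀ i, u i ≠ 0 → z i = 0) (i : Fin r) (hi : z i ≠ 0) :
    u i = 0 := by
  by_contra h'
  exact hi (h i h')

lemma PsiPlus_eventually {c : Fin r → ℝ} (hc : ∀ i, 0 < c i) {u z : Vec r}
    (h : ∀ i, u i ≠ 0 → z i = 0) (hz : ∀ i, 0 ≤ z i) :
    ∀ᶠ z' in 𝓝 z, PsiPlus c z + ((inner ℝ u z' : ℝ) : EReal) ≤ PsiPlus c z' := by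
  rw [PsiPlus_of_nonneg hz]
  filter_upwards [card0_eventually hc (complementary_symm h)] with z' hz'
  exact hz'.trans (card0_le_PsiPlus c z')

end Signs

end CCOP

open CCOP
theorem mainTheorem1 {n m r : ℕ}
    (f : Vec n → EReal) (g : Vec m → EReal)
    (hf : ProperLscConvex f) (hg : ProperLscConvex g)
    (A : Matrix (Fin m) (Fin n) ℝ) (B : Matrix (Fin r) (Fin n) ℝ) (b : Vec r)
    (lam mu : Fin r → ℝ) (hlam : ∀ i, 0 < lam i) (hmu : ∀ i, 0 < mu i) :
    -- the pair `Φ₊`, `Ψ₊`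
    ((∀ xs : Vec n,
        IsLocalMinimizer (primalObj f g A B b (PhiPlus lam)) xs →
        SlaterPPlus f g A B b xs →
        ∃ (ys : Vec m) (zs : Vec r),
          ys ∈ subdiff g (mv A xs) ∧ zs ∈ subdiff (PhiPlus lam) (mv B xs - b) ∧
          IsLocalMinimizer (dualObj f g A B b (PsiPlus mu)) (ys, zs) ∧
          Theta f g A xs = -Xi f g A B b (ys, zs)) ∧
      (∀ ws : Vec m × Vec r,
        IsLocalMinimizer (dualObj f g A B b (PsiPlus mu)) ws →
        SlaterDPlus f g A B ws →
        ∃ xs : Vec n,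
          xs ∈ subdiff (conj f) (-QT A B ws) ∧
          IsLocalMinimizer (primalObj f g A B b (PhiPlus lam)) xs ∧
          Theta f g A xs = -Xi f g A B b ws)) ∧
    -- the pair `Φ₀`, `Ψ₀`
    ((∀ xs : Vec n,
        IsLocalMinimizer (primalObj f g A B b (Phi0 lam)) xs →
        SlaterP0 f g A B b xs →
        ∃ (ys : Vec m) (zs : Vec r),
          ys ∈ subdiff g (mv A xs) ∧ zs ∈ subdiff (Phi0 lam) (mv B xs - b) ∧
          IsLocalMinimizer (dualObj f g A B b (Psi0 mu)) (ys, zs) ∧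
          Theta f g A xs = -Xi f g A B b (ys, zs)) ∧
      (∀ ws : Vec m × Vec r,
        IsLocalMinimizer (dualObj f g A B b (Psi0 mu)) ws →
        SlaterD0 f g A B ws →
        ∃ xs : Vec n,
          xs ∈ subdiff (conj f) (-QT A B ws) ∧
          IsLocalMinimizer (primalObj f g A B b (Phi0 lam)) xs ∧
          Theta f g A xs = -Xi f g A B b ws)) := by
  refine ⟨⟨fun xs hmin hsl => ?_, fun ws hmin hsl => ?_⟩, fun xs hmin hsl => ?_,
    fun ws hmin hsl => ?_⟩
  · obtain ⟨x, hxf, hxg, hx⟩ := hsl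
    have hU : mv B xs - b ∈ signCone (fun i => (mv B xs - b) i = 0) (fun _ => False) :=
      ⟨fun i hi => hi.le, fun _ => False.elim⟩
    refine primal_to_dual hf hg hmin rfl hU ?_
      ⟨x, hxf, hxg, slaterSet_signCone ⟨hx, fun _ => False.elim⟩⟩ fun z hz => ?_
    · filter_upwards [cardPos_eventually_le (c := lam) (mv B xs - b)] with u hu h
      exact hu h.1
    · have h0 : ∀ i, (mv B xs - b) i ≠ 0 → z i = 0 := fun i hi => eq_zero_of_normal hU hz hi hi
      have hn : ∀ i, 0 ≤ z i := fun i => nonneg_of_normal hU hz id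
      exact ⟨inner_eq_zero_of_complementary h0, cardPos_eventually hlam h0 hn,
        ⟨_, PsiPlus_of_nonneg hn⟩, PsiPlus_eventually hmu h0 hn⟩
  · obtain ⟨w, hwf, hwg, hw0, hwn⟩ := hsl
    have hz : ∀ i, 0 ≤ ws.2 i := by
      have hlt : PsiPlus mu ws.2 < ⊤ := by
        rw [lt_top_iff_ne_top]
        intro h
        have h1 := hmin.1
        have h2 : Xi f g A B b ws ≠ ⊥ := by
          simp [Xi, EReal.add_eq_bot_iff, conj_ne_bot hf, conj_ne_bot hg]
        rw [dualObj, h, EReal.add_top_of_ne_bot h2] at h1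
        exact lt_irrefl _ h1
      exact nonneg_of_PsiPlus_lt_top hlt
    have hV : ws.2 ∈ signCone (fun i => ws.2 i = 0) (fun _ => True) :=
      ⟨fun i hi => hi.le, fun i _ => hz i⟩
    refine dual_to_primal hf hg hmin (PsiPlus_of_nonneg hz) hV
      (Eventually.of_forall fun z hzV => ?_)
      ⟨w, hwf, hwg, slaterSet_signCone ⟨fun i hi => (hw0 i hi).le, fun i _ => ?_⟩⟩
      fun u hu => ?_
    · have hzn : ∀ i, 0 ≤ z i := fun i => hzV.2 i trivial
      rw [PsiPlus_of_nonneg hz, PsiPlus_of_nonneg hzn]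
      exact card0_le_of_support hmu fun i hi => le_antisymm (hzV.1 i hi) (hzn i)
    · by_cases hi : ws.2 i = 0
      · exact (hw0 i hi).ge
      · exact hwn i hi
    · have h0 : ∀ i, ws.2 i ≠ 0 → u i = 0 := fun i hi => eq_zero_of_normal hV hu hi hi
      exact ⟨inner_eq_zero_of_complementary h0, ⟨_, rfl⟩,
        cardPos_eventually hlam (complementary_symm h0) hz⟩
  · obtain ⟨x, hxf, hxg, hx⟩ := hsl
    have hU : mv B xs - b ∈
        signCone (fun i => (mv B xs - b) i = 0) (fun i => (mv B xs - b) i = 0) :=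
      ⟨fun i hi => hi.le, fun i hi => hi.ge⟩
    refine primal_to_dual hf hg hmin rfl hU (Eventually.of_forall fun u hu => ?_)
      ⟨x, hxf, hxg, slaterSet_signCone ⟨fun i hi => (hx i hi).le, fun i hi => (hx i hi).ge⟩⟩
      fun z hz => ?_
    · exact card0_le_of_support hlam fun i hi => le_antisymm (hu.1 i hi) (hu.2 i hi)
    · have h0 : ∀ i, (mv B xs - b) i ≠ 0 → z i = 0 := fun i hi => eq_zero_of_normal hU hz hi hi
      exact ⟨inner_eq_zero_of_complementary h0, card0_eventually hlam h0, ⟨_, rfl⟩,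
        card0_eventually hmu (complementary_symm h0)⟩
  · obtain ⟨w, hwf, hwg, hw0⟩ := hsl
    have hV : ws.2 ∈ signCone (fun i => ws.2 i = 0) (fun i => ws.2 i = 0) :=
      ⟨fun i hi => hi.le, fun i hi => hi.ge⟩
    refine dual_to_primal hf hg hmin rfl hV (Eventually.of_forall fun z hzV => ?_)
      ⟨w, hwf, hwg, slaterSet_signCone ⟨fun i hi => (hw0 i hi).le, fun i hi => (hw0 i hi).ge⟩⟩
      fun u hu => ?_
    · exact card0_le_of_support hmu fun i hi => le_antisymm (hzV.1 i hi) (hzV.2 i hi)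
    · have h0 : ∀ i, ws.2 i ≠ 0 → u i = 0 := fun i hi => eq_zero_of_normal hV hu hi hi
      exact ⟨inner_eq_zero_of_complementary h0, ⟨_, rfl⟩,
        card0_eventually hlam (complementary_symm h0)⟩
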